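/- **In-context learning with balanced features.** *Setting.* Let $v_1,\dots,v_K\in\mathbb R^d$ be orthonormal features and let $p_1,\dots,p_K$ be probabilities with $\sum_k p_k=1$. A prompt consists of a weight $w\in\mathbb R^d$ drawn from a law with zero mean and identity covariance, and, independently, of $N$ input tokens $x_1,\dots,x_N$ and a query $x_{\rm query}$ drawn i.i.d. from the law that gives $v_k$ probability $p_k$; put $y_i=\langle w,x_i\rangle$. For $Q\in\mathbb R^{d\times d}$ the one-layer softmax-attention model attends to token $i$ with $\mathrm{attn}_i=e^{x_i^\top Qx_{\rm query}}/\sum_{j\le N}e^{x_j^\top Qx_{\rm query}}$ and predicts $\widehat y=\sum_{i\le N}\mathrm{attn}_i\,y_i$. Put $\mathrm{Attn}_k=\sum_{i:x_i=v_k}\mathrm{attn}_i$, let $L(Q)=\frac12\mathbb E[(\widehat y-\langle w,x_{\rm query}\rangle)^2]$ be the population loss, and let $L^*=\inf_Q L(Q)$. Gradient descent with learning rate $\eta>0$ is $Q^{(0)}=0$, $Q^{(t+1)}=Q^{(t)}-\eta\nabla L(Q^{(t)})$. *Theorem.* Let $0<c_1\le c_2$. There are constants $C,c>0$ depending only on $c_1,c_2$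 such that for every degree $a\in\mathbb N$ there is $K_0$ (depending only on $c_1,c_2,a$) for which the following holds for all $K\ge K_0$, all $d$, all features, all laws of $w$ and all $p$ as above with $c_1/K\le p_k\le c_2/K$ for every $k$ (balanced features, $p_k=\Theta(1/K)$), and all $N\ge K^3$. (0) $e^{-C N/K}\le L^*\le e^{-cN/K}$; so $L^*=e^{-\Theta(N/K)}$, which is $e^{-\mathrm{poly}(K)}$ when $N=\mathrm{poly}(K)$. Moreover, for every $0<\varepsilon<1$ with $\log(1/\varepsilon)\le(\log K)^a$ and every $\eta>0$ there is an iteration $$T\le\left\lceil C\left(\frac{K^2\log K}{\eta}+\frac{K\log(K\varepsilon^{-1/2})}{\varepsilon\eta}\right)\right\rceil$$ such that (1) $L(Q^{(T)})-L^*\le\varepsilon$; (2) for every $k$, if the query token is $v_k$, then with probability at least $1-e^{-cN/K^2}$ over the $N$ input tokens (where $N/K^2\ge K$) the attention score of $Q^{(T)}$ satisfies $(1-\mathrm{Attn}_k)^2\le C\varepsilon$. -/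

import Mathlib

open MeasureTheory
open scoped Matrix

noncomputable section

namespace ICL

/-- The token space `ℝ^d` with its Euclidean norm. -/
abbrev Token (d : ℕ) := EuclideanSpace ℝ (Fin d)

/-- The trainable parameter `Q ∈ ℝ^{d × d}`, with the Frobenius inner product. -/
abbrev Param (d : ℕ) := EuclideanSpace ℝ (Fin d × Fin d)

/-- `Q` as a matrix. -/
def Param.toMatrix {d : ℕ} (Q : Param d) : Matrix (Fin d) (Fin d) ℝ :=
  Matrix.of fun i j => Q (i, j)

/-- The first `d` rows `E^x` of the embedding: the columns are `x_1, …, x_N, x_query`. -/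
def embX {d N : ℕ} (X : Fin N → Token d) (xq : Token d) : Matrix (Fin d) (Fin (N + 1)) ℝ :=
  Matrix.of fun i j => (Fin.snoc (α := fun _ => Token d) X xq j) i

/-- The last row `E^y` of the embedding: `y_1, …, y_N, 0` with `y_i = ⟨w, x_i⟩`. -/
def embY {d N : ℕ} (w : Token d) (X : Fin N → Token d) : Matrix (Fin 1) (Fin (N + 1)) ℝ :=
  Matrix.of fun _ j => Fin.snoc (α := fun _ => ℝ) (fun i => inner ℝ w (X i)) 0 j

/-- Masking: remove the last column. -/
def mask {m : Type*} {N : ℕ} (A : Matrix m (Fin (N + 1)) ℝ) : Matrix m (Fin N) ℝ :=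
  A.submatrix id Fin.castSucc

/-- Column-wise softmax. -/
def softmax {m n : Type*} [Fintype m] (A : Matrix m n ℝ) : Matrix m n ℝ :=
  Matrix.of fun i j => Real.exp (A i j) / ∑ s, Real.exp (A s j)

/-- The attention matrix `softmax(M(E^x)ᵀ Q E^x)`. -/
def attnMatrix {d N : ℕ} (Q : Param d) (Ex : Matrix (Fin d) (Fin (N + 1)) ℝ) :
    Matrix (Fin N) (Fin (N + 1)) ℝ :=
  softmax ((mask Ex)ᵀ * Q.toMatrix * Ex)

/-- The one-layer softmax transformer `M(E^y) · softmax(M(E^x)ᵀ Q E^x)`. -/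
def transformer {d N : ℕ} (Q : Param d) (Ex : Matrix (Fin d) (Fin (N + 1)) ℝ)
    (Ey : Matrix (Fin 1) (Fin (N + 1)) ℝ) : Matrix (Fin 1) (Fin (N + 1)) ℝ :=
  mask Ey * attnMatrix Q Ex

/-- The prediction for the query token: the last entry of the transformer output. -/
def predict {d N : ℕ} (Q : Param d) (w : Token d) (X : Fin N → Token d) (xq : Token d) : ℝ :=
  transformer Q (embX X xq) (embY w X) 0 (Fin.last N)

/-- Attention score of the query for the `i`-th input token. -/
def tokenAttn {d N : ℕ} (Q : Param d) (X : Fin N → Token d) (xq : Token d) (i : Fin N) : ℝ :=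
  attnMatrix Q (embX X xq) i (Fin.last N)

open scoped Classical in
/-- Attention score of the query for the `k`-th feature: the sum of the attention scores of the
input tokens equal to `v_k`. -/
def featureAttn {d K N : ℕ} (Q : Param d) (v : Fin K → Token d) (X : Fin N → Token d)
    (xq : Token d) (k : Fin K) : ℝ :=
  ∑ i ∈ Finset.univ.filter (fun i => X i = v k), tokenAttn Q X xq i

/-- The data distribution: the feature `v_k` is drawn with probability `p_k`. -/
def dataDist {d K : ℕ} (v : Fin K → Token d) (p : Fin K → ℝ) : Measure (Token d) :=
  ∑ k, ENNReal.ofReal (p k) • Measure.dirac (v k)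

/-- The joint law of `N` independent input tokens. -/
def inputDist {d K : ℕ} (v : Fin K → Token d) (p : Fin K → ℝ) (N : ℕ) :
    Measure (Fin N → Token d) :=
  Measure.pi fun _ => dataDist v p

/-- A task distribution: a law of the weight vector `w` with zero mean and identity covariance. -/
structure IsTaskDist {d : ℕ} (μ : Measure (Token d)) : Prop where
  isProbabilityMeasure : IsProbabilityMeasure μ
  memLp : MemLp id 2 μ
  mean : ∫ w, w ∂μ = 0
  cov : ∀ i j, ∫ w, w i * w j ∂μ = if i = j then 1 else 0

/-- The population loss: half the expected squared prediction error, over independent task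
weight, input tokens and query token. -/
def loss {d K : ℕ} (μ : Measure (Token d)) (v : Fin K → Token d) (p : Fin K → ℝ) (N : ℕ)
    (Q : Param d) : ℝ :=
  (1 / 2) * ∫ z : Token d × (Fin N → Token d) × Token d,
    (predict Q z.1 z.2.1 z.2.2 - inner ℝ z.1 z.2.2) ^ 2
      ∂(μ.prod ((inputDist v p N).prod (dataDist v p)))

/-- The optimal value of the population loss over all `Q` (the loss is nonnegative). -/
def optLoss {d K : ℕ} (μ : Measure (Token d)) (v : Fin K → Token d) (p : Fin K → ℝ) (N : ℕ) : ℝ :=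
  ⨅ Q : Param d, loss μ v p N Q

/-- Gradient descent on the population loss with learning rate `η`, started at `Q = 0`. -/
def gd {d K : ℕ} (μ : Measure (Token d)) (v : Fin K → Token d) (p : Fin K → ℝ) (N : ℕ)
    (η : ℝ) : ℕ → Param d
  | 0 => 0
  | t + 1 => gd μ v p N η t - η • gradient (loss μ v p N) (gd μ v p N η t)

end ICL

end

/-!
Averaging over the task weight turns the squared error for the query `v_k` into
`∑ j, (Attn_j - δ_jk) ^ 2`, where `Attn_j` is the total attention on the feature `v_j` (`loss_eq`).
It depends on `Q` only through the logits `b n = v_nᵀ Q v_k`, and on the prompt only through the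
counts of the features. Since the features are orthonormal, gradient descent moves the logits of
different queries independently of each other (`logit_gd_succ`): with step `η p_k` they follow
`force`, which at the item `n` is the expectation of
`Attn_n (δ_nk - Attn_n + ∑ j, Attn_j ^ 2 - Attn_k)`.

A Chernoff bound shows that, outside an event of probability `e ^ (-c N / K)`, the counts are
balanced: they agree up to a constant factor `ρ` (`sum_drawProb_not_balanced`). For a fixed query
`k` and balanced counts the dynamics has two stages, separated by the level
`A = log (8 ρ K / √ε)` of the logit `b k` (`lead_of_steps`).

* Below `A`, the attention on the wrong features is spread evenly, so the force on a wrong logit is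
  `O(1 / K)` times the force on `b k` (`abs_force_le`). As `A` is only polylogarithmic in `K`, the
  wrong logits stay bounded. The force on `b k` is at least of order `min (1 / K) ε`
  (`le_force_self_of_lt`), which gives the number of steps.
* Above `A`, most of the attention is on `k`, and then no wrong logit grows faster than `b k`
  (`force_le_force_self`). The lead of `b k` is lost only through unbalanced prompts, whose
  contribution over the whole run is bounded because their probability is so small.

The step size does not enter: the force on `b k` is nonnegative, both comparisons are between the
increments of one step, and a step that overshoots `A` only enlarges the lead. Hence a single
number of steps serves all queries. The lead of `b k` makes `1 - Attn_k ≤ √ε / 2` on balanced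
prompts, which yields both the bound on the loss and the bound on the attention score.

The optimal loss is of the order of the probability `(1 - p_k) ^ N` that the feature of the query
does not occur in the prompt: then the error is at least `1` (`exp_le_optLoss`), while otherwise
the parameter `s ∑ v_k v_kᵀ` makes it as small as desired (`optLoss_le_exp`).
-/

noncomputable section

namespace ICL

/-! ### The law of the prompt as a finite sum of point masses -/

/-- The probability `∏ i, p (f i)` that the `N` input tokens are the features with indices `f`. -/
def drawProb {K N : ℕ} (p : Fin K → ℝ) (f : Fin N → Fin K) : ℝ := ∏ i, p (f i)

lemma drawProb_nonneg {K N : ℕ} {p : Fin K → ℝ} (hp : ∀ k, 0 ≤ p k) (f : Fin N → Fin K) :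
    0 ≤ drawProb p f := Finset.prod_nonneg fun i _ => hp (f i)

/-- Expectations of products of functions of the single tokens factor. -/
lemma sum_drawProb_mul_prod {K N : ℕ} (p φ : Fin K → ℝ) :
    ∑ f : Fin N → Fin K, drawProb p f * ∏ i, φ (f i) = (∑ k, p k * φ k) ^ N := by
  have h := Finset.prod_univ_sum (fun _ : Fin N => (Finset.univ : Finset (Fin K)))
    (fun _ k => p k * φ k)
  simp only [Finset.prod_const, Finset.card_univ, Fintype.card_fin, Fintype.piFinset_univ] at h
  rw [h]
  exact Finset.sum_congr rfl fun f _ => by rw [drawProb, Finset.prod_mul_distrib]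

lemma sum_drawProb {K N : ℕ} {p : Fin K → ℝ} (hp1 : ∑ k, p k = 1) :
    ∑ f : Fin N → Fin K, drawProb p f = 1 := by
  simpa [hp1] using sum_drawProb_mul_prod (N := N) p (fun _ => 1)

instance {d K : ℕ} (v : Fin K → Token d) (p : Fin K → ℝ) : IsFiniteMeasure (dataDist v p) :=
  ⟨by simp [dataDist, Measure.finsetSum_apply]⟩

instance {d K : ℕ} (v : Fin K → Token d) (p : Fin K → ℝ) (N : ℕ) :
    IsFiniteMeasure (inputDist v p N) := by
  unfold inputDist; infer_instance

lemma inputDist_eq_sum {d K : ℕ} (v : Fin K → Token d) {p : Fin K → ℝ} (hp : ∀ k, 0 ≤ p k)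
    (N : ℕ) :
    inputDist v p N =
      ∑ f : Fin N → Fin K, ENNReal.ofReal (drawProb p f) • Measure.dirac (fun i => v (f i)) := by
  refine Measure.pi_eq fun s hs => ?_
  simp only [dataDist, Measure.finsetSum_apply, Measure.smul_apply, Measure.dirac_apply,
    smul_eq_mul]
  rw [Finset.prod_univ_sum]
  simp only [Fintype.piFinset_univ]
  refine Finset.sum_congr rfl fun f _ => ?_
  rw [Finset.prod_mul_distrib, drawProb, ENNReal.ofReal_prod_of_nonneg fun i _ => hp _]
  congr 1
  by_cases h : ∀ i, v (f i) ∈ s i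
  · rw [Set.indicator_of_mem (by simpa using h)]
    simp [h]
  · rw [Set.indicator_of_notMem (by simpa using h)]
    push Not at h
    obtain ⟨i, hi⟩ := h
    exact (Finset.prod_eq_zero (Finset.mem_univ i) (by simp [hi])).symm

lemma inputDist_real {d K : ℕ} (v : Fin K → Token d) {p : Fin K → ℝ} (hp : ∀ k, 0 ≤ p k)
    (N : ℕ) (s : Set (Fin N → Token d)) [DecidablePred (· ∈ s)] :
    (inputDist v p N).real s =
      ∑ f : Fin N → Fin K, if (fun i => v (f i)) ∈ s then drawProb p f else 0 := by
  rw [inputDist_eq_sum v hp, Measure.real, Measure.finsetSum_apply, ENNReal.toReal_sum]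
  · refine Finset.sum_congr rfl fun f _ => ?_
    rw [Measure.smul_apply, Measure.dirac_apply, smul_eq_mul]
    split_ifs with h
    · simp [h, drawProb_nonneg hp]
    · simp [h]
  · intro f _
    rw [Measure.smul_apply, Measure.dirac_apply, smul_eq_mul]
    by_cases h : (fun i => v (f i)) ∈ s <;> simp [h]

/-- Integration against a product with a finite combination of point masses. -/
lemma integral_prod_sum_dirac {α β ι : Type*} [MeasurableSpace α] [MeasurableSpace β]
    [MeasurableSingletonClass β] [Fintype ι] (μ : Measure α) [IsFiniteMeasure μ]
    (c : ι → ℝ) (hc : ∀ i, 0 ≤ c i) (y : ι → β) (F : α × β → ℝ)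
    (hF : ∀ i, Integrable (fun x => F (x, y i)) μ) :
    ∫ z, F z ∂(μ.prod (∑ i, ENNReal.ofReal (c i) • Measure.dirac (y i))) =
      ∑ i, c i * ∫ x, F (x, y i) ∂μ := by
  have : IsFiniteMeasure (∑ i, ENNReal.ofReal (c i) • Measure.dirac (y i)) :=
    ⟨by simp [Measure.finsetSum_apply]⟩
  have hprod : μ.prod (∑ i, ENNReal.ofReal (c i) • Measure.dirac (y i)) =
      ∑ i, ENNReal.ofReal (c i) • μ.map (fun x => (x, y i)) := by
    refine Measure.prod_eq fun s t hs ht => ?_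
    simp only [Measure.finsetSum_apply, Measure.smul_apply, smul_eq_mul, Finset.mul_sum]
    refine Finset.sum_congr rfl fun i _ => ?_
    rw [Measure.map_apply (by fun_prop) (hs.prod ht), Measure.dirac_apply]
    by_cases h : y i ∈ t
    · simp [h, mul_comm]
    · simp [h]
  have hemb : ∀ i, MeasurableEmbedding fun x : α => (x, y i) := fun i =>
    measurableEmbedding_prod_mk_right (y i)
  rw [hprod, integral_finsetSum_measure]
  · refine Finset.sum_congr rfl fun i _ => ?_
    rw [integral_smul_measure, (hemb i).integral_map, ENNReal.toReal_ofReal (hc i), smul_eq_mul]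
  · intro i _
    exact (((hemb i).integrable_map_iff).2 (hF i)).smul_measure ENNReal.ofReal_ne_top

/-! ### Averaging over the task weight -/

lemma IsTaskDist.integrable_mul {d : ℕ} {μ : Measure (Token d)} (hμ : IsTaskDist μ)
    (i j : Fin d) : Integrable (fun w : Token d => w i * w j) μ := by
  have h : ∀ i, MemLp (fun w : Token d => w i) 2 μ := fun i => by
    refine hμ.memLp.of_le (by fun_prop) (Filter.Eventually.of_forall fun w => ?_)
    exact PiLp.norm_apply_le w i
  exact (h i).integrable_mul (h j)

lemma inner_sq_eq_sum {d : ℕ} (w u : Token d) :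
    inner ℝ w u ^ 2 = ∑ i, ∑ j, (u i * u j) * (w i * w j) := by
  rw [PiLp.inner_apply, sq, Finset.sum_mul_sum]
  refine Finset.sum_congr rfl fun i _ => Finset.sum_congr rfl fun j _ => ?_
  simp only [RCLike.inner_apply, conj_trivial]
  ring

lemma IsTaskDist.integrable_inner_sq {d : ℕ} {μ : Measure (Token d)} (hμ : IsTaskDist μ)
    (u : Token d) : Integrable (fun w => inner ℝ w u ^ 2) μ := by
  simp only [inner_sq_eq_sum]
  exact integrable_finsetSum _ fun i _ => integrable_finsetSum _ fun j _ =>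
    (hμ.integrable_mul i j).const_mul _

lemma IsTaskDist.integral_inner_sq {d : ℕ} {μ : Measure (Token d)} (hμ : IsTaskDist μ)
    (u : Token d) : ∫ w, inner ℝ w u ^ 2 ∂μ = ‖u‖ ^ 2 := by
  simp only [inner_sq_eq_sum]
  rw [integral_finsetSum _ fun i _ => integrable_finsetSum _ fun j _ =>
    (hμ.integrable_mul i j).const_mul _]
  rw [EuclideanSpace.norm_sq_eq]
  refine Finset.sum_congr rfl fun i _ => ?_
  rw [integral_finsetSum _ fun j _ => (hμ.integrable_mul i j).const_mul _]
  simp only [integral_const_mul, hμ.cov]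
  simp [sq]

/-! ### The attention scores in terms of feature counts -/

/-- The bilinear form `xᵀ Q y`, the logit with which the query `y` attends to the token `x`. -/
def logit {d : ℕ} (Q : Param d) (x y : Token d) : ℝ := ∑ b, (∑ a, x a * Q (a, b)) * y b

lemma tokenAttn_eq {d N : ℕ} (Q : Param d) (X : Fin N → Token d) (xq : Token d) (i : Fin N) :
    tokenAttn Q X xq i = Real.exp (logit Q (X i) xq) / ∑ s, Real.exp (logit Q (X s) xq) := by
  have h : ∀ i, ((mask (embX X xq))ᵀ * Q.toMatrix * embX X xq) i (Fin.last N) =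
      logit Q (X i) xq := fun i => by
    simp [Matrix.mul_apply, mask, embX, Param.toMatrix, logit]
  simp only [tokenAttn, attnMatrix, softmax, Matrix.of_apply, h]

lemma predict_eq {d N : ℕ} (Q : Param d) (w : Token d) (X : Fin N → Token d) (xq : Token d) :
    predict Q w X xq = inner ℝ w (∑ i, tokenAttn Q X xq i • X i) := by
  simp only [predict, transformer, Matrix.mul_apply, inner_sum, inner_smul_right]
  refine Finset.sum_congr rfl fun i _ => ?_
  simp [mask, embY, tokenAttn, mul_comm]

/-- The number of input tokens equal to the feature `j`. -/
def count {K N : ℕ} (f : Fin N → Fin K) (j : Fin K) : ℝ :=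
  ((Finset.univ.filter fun i => f i = j).card : ℝ)

lemma count_nonneg {K N : ℕ} (f : Fin N → Fin K) (j : Fin K) : 0 ≤ count f j :=
  Nat.cast_nonneg _

lemma sum_count_mul {K N : ℕ} (f : Fin N → Fin K) (φ : Fin K → ℝ) :
    ∑ j, count f j * φ j = ∑ i, φ (f i) := by
  rw [← Finset.sum_fiberwise (s := Finset.univ) (g := f) (f := fun i => φ (f i))]
  refine Finset.sum_congr rfl fun j _ => ?_
  rw [Finset.sum_congr rfl (g := fun _ => φ j) (by intro i hi; simp_all)]
  simp [count]

lemma sum_count {K N : ℕ} (f : Fin N → Fin K) : ∑ j, count f j = N := by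
  simpa using sum_count_mul f fun _ => 1

/-- The softmax with logits `b` in which item `j` occurs with multiplicity `c j`: the total
attention on the copies of item `j`. -/
def groupAttn {K : ℕ} (c b : Fin K → ℝ) (j : Fin K) : ℝ :=
  c j * Real.exp (b j) / ∑ m, c m * Real.exp (b m)

lemma tokenAttn_feature {d K N : ℕ} (Q : Param d) (v : Fin K → Token d) (f : Fin N → Fin K)
    (k : Fin K) (i : Fin N) :
    tokenAttn Q (fun i => v (f i)) (v k) i =
      Real.exp (logit Q (v (f i)) (v k)) /
        ∑ m, count f m * Real.exp (logit Q (v m) (v k)) := by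
  rw [tokenAttn_eq, sum_count_mul f fun m => Real.exp (logit Q (v m) (v k))]

lemma sum_tokenAttn_smul {d K N : ℕ} (Q : Param d) (v : Fin K → Token d) (f : Fin N → Fin K)
    (k : Fin K) :
    ∑ i, tokenAttn Q (fun i => v (f i)) (v k) i • v (f i) =
      ∑ j, groupAttn (count f) (fun n => logit Q (v n) (v k)) j • v j := by
  rw [← Finset.sum_fiberwise (s := Finset.univ) (g := f)]
  refine Finset.sum_congr rfl fun j _ => ?_
  simp only [tokenAttn_feature]
  rw [Finset.sum_congr rfl (g := fun _ => (Real.exp (logit Q (v j) (v k)) /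
        ∑ m, count f m * Real.exp (logit Q (v m) (v k))) • v j) (by intro i hi; simp_all)]
  rw [Finset.sum_const, ← Nat.cast_smul_eq_nsmul ℝ, smul_smul, groupAttn, count]
  congr 1
  ring

lemma featureAttn_eq {d K N : ℕ} (Q : Param d) {v : Fin K → Token d}
    (hv : Function.Injective v) (f : Fin N → Fin K) (k j : Fin K) :
    featureAttn Q v (fun i => v (f i)) (v k) j =
      groupAttn (count f) (fun n => logit Q (v n) (v k)) j := by
  classical
  simp only [featureAttn, tokenAttn_feature, hv.eq_iff]
  rw [Finset.sum_congr rfl (g := fun _ => Real.exp (logit Q (v j) (v k)) /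
        ∑ m, count f m * Real.exp (logit Q (v m) (v k))) (by intro i hi; simp_all)]
  rw [Finset.sum_const, nsmul_eq_mul, groupAttn, count]
  rw [mul_div_assoc]

/-! ### The loss as a sum over queries -/

/-- The expected squared error for the query `v_k`, up to the factor `1/2` and after averaging
over the task weight, as a function of the logits `b` of that query. -/
def queryLoss {K : ℕ} (p : Fin K → ℝ) (N : ℕ) (k : Fin K) (b : Fin K → ℝ) : ℝ :=
  ∑ f : Fin N → Fin K,
    drawProb p f * ∑ j, (groupAttn (count f) b j - if j = k then 1 else 0) ^ 2

lemma norm_sq_sum_smul_sub {d K : ℕ} {v : Fin K → Token d} (hv : Orthonormal ℝ v)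
    (a : Fin K → ℝ) (k : Fin K) :
    ‖∑ j, a j • v j - v k‖ ^ 2 = ∑ j, (a j - if j = k then 1 else 0) ^ 2 := by
  have h : ∑ j, a j • v j - v k = ∑ j, (a j - if j = k then 1 else 0) • v j := by
    simp [sub_smul, Finset.sum_sub_distrib]
  rw [h, ← real_inner_self_eq_norm_sq, hv.inner_sum]
  simp [sq]

theorem loss_eq {d K : ℕ} {μ : Measure (Token d)} (hμ : IsTaskDist μ) {v : Fin K → Token d}
    (hv : Orthonormal ℝ v) {p : Fin K → ℝ} (hp : ∀ k, 0 ≤ p k) (N : ℕ) (Q : Param d) :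
    loss μ v p N Q =
      ∑ k, p k * (1 / 2 * queryLoss p N k (fun n => logit Q (v n) (v k))) := by
  have := hμ.isProbabilityMeasure
  have hprod : (inputDist v p N).prod (dataDist v p) =
      ∑ q : (Fin N → Fin K) × Fin K,
        ENNReal.ofReal (drawProb p q.1 * p q.2) •
          Measure.dirac ((fun i => v (q.1 i)), v q.2) := by
    refine Measure.prod_eq fun s t hs ht => ?_
    rw [inputDist_eq_sum v hp, dataDist]
    simp only [Measure.finsetSum_apply, Measure.smul_apply, Measure.dirac_apply, smul_eq_mul]
    rw [Fintype.sum_prod_type, Finset.sum_mul_sum]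
    refine Finset.sum_congr rfl fun f _ => Finset.sum_congr rfl fun k _ => ?_
    rw [ENNReal.ofReal_mul (drawProb_nonneg hp f)]
    by_cases h1 : (fun i => v (f i)) ∈ s <;> by_cases h2 : v k ∈ t <;>
      simp [Set.indicator, h1, h2]
  have herr : ∀ (w : Token d) (f : Fin N → Fin K) (k : Fin K),
      predict Q w (fun i => v (f i)) (v k) - inner ℝ w (v k) = inner ℝ w
        (∑ j, groupAttn (count f) (fun n => logit Q (v n) (v k)) j • v j - v k) := by
    intro w f k
    rw [predict_eq, sum_tokenAttn_smul, inner_sub_right]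
  rw [loss, hprod, integral_prod_sum_dirac μ (fun q : (Fin N → Fin K) × Fin K => drawProb p q.1 * p q.2)
    (fun q => mul_nonneg (drawProb_nonneg hp q.1) (hp q.2))
    (fun q => ((fun i => v (q.1 i)), v q.2))]
  · simp only [herr, hμ.integral_inner_sq, norm_sq_sum_smul_sub hv]
    rw [Fintype.sum_prod_type, Finset.sum_comm, Finset.mul_sum]
    refine Finset.sum_congr rfl fun k _ => ?_
    rw [queryLoss, Finset.mul_sum, Finset.mul_sum, Finset.mul_sum]
    refine Finset.sum_congr rfl fun f _ => ?_
    ring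
  · intro q
    simp only [herr]
    exact hμ.integrable_inner_sq _

/-! ### The gradient of the loss -/

/-- The negative gradient of half the `queryLoss`, in the direction of the logit of item `n`. -/
def force {K : ℕ} (p : Fin K → ℝ) (N : ℕ) (k : Fin K) (b : Fin K → ℝ) (n : Fin K) : ℝ :=
  ∑ f : Fin N → Fin K, drawProb p f * (groupAttn (count f) b n *
    ((if n = k then 1 else 0) - groupAttn (count f) b n +
      ∑ j, groupAttn (count f) b j ^ 2 - groupAttn (count f) b k))

lemma sum_count_mul_exp_pos {K N : ℕ} (hN : 0 < N) (f : Fin N → Fin K) (b : Fin K → ℝ) :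
    0 < ∑ m, count f m * Real.exp (b m) := by
  rw [sum_count_mul f fun m => Real.exp (b m)]
  have : Nonempty (Fin N) := ⟨⟨0, hN⟩⟩
  exact Finset.sum_pos (fun i _ => Real.exp_pos _) Finset.univ_nonempty

lemma hasFDerivAt_groupAttn {K : ℕ} (c b : Fin K → ℝ)
    (hZ : ∑ m, c m * Real.exp (b m) ≠ 0) (j : Fin K) :
    HasFDerivAt (fun b => groupAttn c b j)
      (groupAttn c b j • (ContinuousLinearMap.proj j -
        ∑ n, groupAttn c b n • (ContinuousLinearMap.proj n : (Fin K → ℝ) →L[ℝ] ℝ))) b := by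
  have hb : ∀ n, HasFDerivAt (fun b : Fin K → ℝ => b n)
      (ContinuousLinearMap.proj n : (Fin K → ℝ) →L[ℝ] ℝ) b := fun n =>
    (ContinuousLinearMap.proj n : (Fin K → ℝ) →L[ℝ] ℝ).hasFDerivAt
  have hn : ∀ n, HasFDerivAt (fun b : Fin K → ℝ => c n * Real.exp (b n))
      (c n • Real.exp (b n) • (ContinuousLinearMap.proj n : (Fin K → ℝ) →L[ℝ] ℝ)) b := fun n =>
    (hb n).exp.const_mul _
  have h := (hn j).mul ((hasDerivAt_inv hZ).comp_hasFDerivAt b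
    (HasFDerivAt.fun_sum fun n (_ : n ∈ Finset.univ) => hn n))
  refine h.congr_fderiv ?_
  ext u
  simp only [groupAttn, smul_apply, sub_apply,
    sum_apply, ContinuousLinearMap.proj_apply, smul_eq_mul]
  set Z := ∑ m, c m * Real.exp (b m)
  have : ∑ n, c n * Real.exp (b n) / Z * u n = (∑ n, c n * (Real.exp (b n) * u n)) / Z := by
    rw [Finset.sum_div]
    exact Finset.sum_congr rfl fun n _ => by ring
  rw [this]
  simp only [add_apply, smul_apply, sum_apply, ContinuousLinearMap.proj_apply, smul_eq_mul,
    Function.comp_apply]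
  change c j * Real.exp (b j) * (-(Z ^ 2)⁻¹ * _) + Z⁻¹ * _ = _
  field_simp
  ring

lemma sum_groupAttn {K : ℕ} {c b : Fin K → ℝ} (hZ : ∑ m, c m * Real.exp (b m) ≠ 0) :
    ∑ j, groupAttn c b j = 1 := by
  simp only [groupAttn]
  rw [← Finset.sum_div, div_self hZ]

lemma hasFDerivAt_queryLoss {K N : ℕ} (hN : 0 < N) (p : Fin K → ℝ) (k : Fin K)
    (b : Fin K → ℝ) :
    HasFDerivAt (fun b => 1 / 2 * queryLoss p N k b)
      (-∑ n, force p N k b n • (ContinuousLinearMap.proj n : (Fin K → ℝ) →L[ℝ] ℝ)) b := by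
  have h := (HasFDerivAt.fun_sum fun f (_ : f ∈ (Finset.univ : Finset (Fin N → Fin K))) =>
    (HasFDerivAt.fun_sum fun j (_ : j ∈ (Finset.univ : Finset (Fin K))) =>
      ((hasFDerivAt_groupAttn (count f) b (sum_count_mul_exp_pos hN f b).ne' j).sub_const
        (if j = k then (1 : ℝ) else 0)).pow 2).const_mul (drawProb p f)).const_mul (1 / 2 : ℝ)
  refine h.congr_fderiv ?_
  ext u
  simp only [smul_apply, sub_apply,
    sum_apply, ContinuousLinearMap.proj_apply, smul_eq_mul,
    neg_apply, force, Finset.sum_mul]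
  rw [Finset.mul_sum, Finset.sum_comm, ← Finset.sum_neg_distrib]
  refine Finset.sum_congr rfl fun f _ => ?_
  set α := groupAttn (count f) b
  have hS : ∑ j, (α j - if j = k then 1 else 0) * α j = ∑ j, α j ^ 2 - α k := by
    simp [sub_mul, Finset.sum_sub_distrib, sq]
  have e : ∑ j, (α j - if j = k then 1 else 0) * (α j * (u j - ∑ n, α n * u n)) =
      ∑ j, (α j - if j = k then 1 else 0) * α j * u j
        - (∑ j, α j ^ 2 - α k) * ∑ n, α n * u n := by
    rw [← hS, Finset.sum_mul, ← Finset.sum_sub_distrib]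
    exact Finset.sum_congr rfl fun j _ => by ring
  have e' : ∑ j, 2 * (α j - if j = k then 1 else 0) * (α j * (u j - ∑ n, α n * u n)) =
      2 * -∑ n, α n * ((if n = k then 1 else 0) - α n + ∑ j, α j ^ 2 - α k) * u n := by
    simp only [mul_assoc (2 : ℝ)]
    rw [← Finset.mul_sum, e, Finset.mul_sum, ← Finset.sum_sub_distrib, ← Finset.sum_neg_distrib]
    congr 1
    exact Finset.sum_congr rfl fun j _ => by ring
  simp only [Nat.add_one_sub_one, pow_one, nsmul_eq_mul, Nat.cast_ofNat]
  rw [e']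
  simp only [mul_assoc]
  rw [← Finset.mul_sum]
  ring

lemma logit_add {d : ℕ} (Q R : Param d) (x y : Token d) :
    logit (Q + R) x y = logit Q x y + logit R x y := by
  simp [logit, mul_add, add_mul, Finset.sum_add_distrib]

lemma logit_smul {d : ℕ} (r : ℝ) (Q : Param d) (x y : Token d) :
    logit (r • Q) x y = r * logit Q x y := by
  simp only [logit, PiLp.smul_apply, smul_eq_mul, Finset.mul_sum, Finset.sum_mul]
  exact Finset.sum_congr rfl fun _ _ => Finset.sum_congr rfl fun _ _ => by ring

/-- The rank-one parameter `x yᵀ`. -/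
def outer {d : ℕ} (x y : Token d) : Param d := WithLp.toLp 2 fun q => x q.1 * y q.2

lemma inner_outer {d : ℕ} (Q : Param d) (x y : Token d) : inner ℝ (outer x y) Q = logit Q x y := by
  rw [PiLp.inner_apply, Fintype.sum_prod_type, logit, Finset.sum_comm]
  simp only [Finset.sum_mul]
  refine Finset.sum_congr rfl fun _ _ => Finset.sum_congr rfl fun _ _ => ?_
  simp only [outer, RCLike.inner_apply, conj_trivial]
  ring

lemma logit_outer {d : ℕ} (x y x' y' : Token d) :
    logit (outer x y) x' y' = inner ℝ x x' * inner ℝ y y' := by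
  simp only [logit, outer, PiLp.inner_apply, RCLike.inner_apply, conj_trivial,
    Finset.sum_mul, Finset.mul_sum]
  refine Finset.sum_congr rfl fun _ _ => Finset.sum_congr rfl fun _ _ => ?_
  ring

lemma hasFDerivAt_logit {d K : ℕ} (v : Fin K → Token d) (k : Fin K) (Q : Param d) :
    HasFDerivAt (fun Q => fun n => logit Q (v n) (v k))
      (ContinuousLinearMap.pi fun n => innerSL ℝ (outer (v n) (v k))) Q := by
  simp only [← inner_outer]
  exact (ContinuousLinearMap.pi fun n => innerSL ℝ (outer (v n) (v k))).hasFDerivAt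

theorem gradient_loss {d K : ℕ} {μ : Measure (Token d)} (hμ : IsTaskDist μ)
    {v : Fin K → Token d} (hv : Orthonormal ℝ v) {p : Fin K → ℝ} (hp : ∀ k, 0 ≤ p k) {N : ℕ}
    (hN : 0 < N) (Q : Param d) :
    gradient (loss μ v p N) Q =
      -∑ k, ∑ n, (p k * force p N k (fun n => logit Q (v n) (v k)) n) • outer (v n) (v k) := by
  apply HasGradientAt.gradient
  rw [hasGradientAt_iff_hasFDerivAt]
  have h : loss μ v p N = fun Q =>
      ∑ k, p k * (1 / 2 * queryLoss p N k (fun n => logit Q (v n) (v k))) :=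
    funext fun Q => loss_eq hμ hv hp N Q
  rw [h]
  have h' := HasFDerivAt.fun_sum fun k (_ : k ∈ (Finset.univ : Finset (Fin K))) =>
    ((hasFDerivAt_queryLoss hN p k (fun n => logit Q (v n) (v k))).comp Q
      (hasFDerivAt_logit v k Q)).const_mul (p k)
  refine h'.congr_fderiv ?_
  ext u
  simp [Finset.mul_sum, mul_assoc]

/-- Along gradient descent the logits of different queries evolve independently. -/
theorem logit_gd_succ {d K : ℕ} {μ : Measure (Token d)} (hμ : IsTaskDist μ)
    {v : Fin K → Token d} (hv : Orthonormal ℝ v) {p : Fin K → ℝ} (hp : ∀ k, 0 ≤ p k) {N : ℕ}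
    (hN : 0 < N) (η : ℝ) (t : ℕ) (n k : Fin K) :
    logit (gd μ v p N η (t + 1)) (v n) (v k) = logit (gd μ v p N η t) (v n) (v k) +
      η * p k * force p N k (fun n => logit (gd μ v p N η t) (v n) (v k)) n := by
  have hsum : ∀ (F : Fin K → Fin K → ℝ),
      logit (∑ k, ∑ n, F k n • outer (v n) (v k)) (v n) (v k) = F k n := by
    intro F
    rw [← inner_outer]
    simp only [inner_sum, inner_smul_right, inner_outer, logit_outer,
      orthonormal_iff_ite.1 hv]
    simp
  rw [gd, gradient_loss hμ hv hp hN, smul_neg, sub_neg_eq_add, logit_add, logit_smul, hsum]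
  ring

/-! ### Concentration of the feature counts -/

lemma exp_mul_count {K N : ℕ} (s : ℝ) (f : Fin N → Fin K) (j : Fin K) :
    Real.exp (s * count f j) = ∏ i, if f i = j then Real.exp s else 1 := by
  rw [Finset.prod_ite, Finset.prod_const, Finset.prod_const_one, mul_one, ← Real.exp_nat_mul,
    count, mul_comm]

lemma sum_mul_ite_eq {K : ℕ} {p : Fin K → ℝ} (hp1 : ∑ k, p k = 1) (j : Fin K) (x : ℝ) :
    ∑ k, p k * (if k = j then x else 1) = 1 + p j * (x - 1) := by
  have h : ∀ k, p k * (if k = j then x else 1) = p k + if k = j then p k * (x - 1) else 0 := by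
    intro k
    split_ifs <;> ring
  simp [h, Finset.sum_add_distrib, hp1]

/-- The moment generating function of a binomial variable is at most that of a Poisson variable
with the same mean. -/
lemma sum_drawProb_exp_count_le {K N : ℕ} {p : Fin K → ℝ} (hp : ∀ k, 0 ≤ p k)
    (hp1 : ∑ k, p k = 1) (s : ℝ) (j : Fin K) :
    ∑ f : Fin N → Fin K, drawProb p f * Real.exp (s * count f j) ≤
      Real.exp (p j * N * (Real.exp s - 1)) := by
  simp only [exp_mul_count]
  rw [sum_drawProb_mul_prod p fun k => if k = j then Real.exp s else 1, sum_mul_ite_eq hp1,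
    mul_right_comm, mul_comm _ (N : ℝ), Real.exp_nat_mul]
  have hpj : p j ≤ 1 := hp1 ▸ Finset.single_le_sum (fun k _ => hp k) (Finset.mem_univ j)
  refine pow_le_pow_left₀ ?_ ?_ N
  · nlinarith [Real.exp_pos s, hp j]
  · linarith [Real.add_one_le_exp (p j * (Real.exp s - 1))]

/-- The exponential Markov inequality for the count of the feature `j`. -/
lemma chernoff_count {K N : ℕ} {p : Fin K → ℝ} (hp : ∀ k, 0 ≤ p k) (hp1 : ∑ k, p k = 1)
    (s y : ℝ) (j : Fin K) :
    ∑ f : Fin N → Fin K, (if y < s * count f j then drawProb p f else 0) ≤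
      Real.exp (p j * N * (Real.exp s - 1) - y) := by
  calc ∑ f : Fin N → Fin K, (if y < s * count f j then drawProb p f else 0)
      ≤ ∑ f : Fin N → Fin K, drawProb p f * Real.exp (s * count f j) * Real.exp (-y) := by
        refine Finset.sum_le_sum fun f _ => ?_
        have h0 := drawProb_nonneg hp f
        split_ifs with h
        · rw [mul_assoc, ← Real.exp_add]
          exact le_mul_of_one_le_right h0 (Real.one_le_exp (by linarith))
        · positivity
    _ ≤ _ := by
        rw [← Finset.sum_mul, sub_eq_add_neg, Real.exp_add]
        exact mul_le_mul_of_nonneg_right (sum_drawProb_exp_count_le hp hp1 s j)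
          (Real.exp_pos _).le

lemma sum_drawProb_count_gt {K N : ℕ} {p : Fin K → ℝ} (hp : ∀ k, 0 ≤ p k)
    (hp1 : ∑ k, p k = 1) (j : Fin K) :
    ∑ f : Fin N → Fin K, (if 2 * (p j * N) < count f j then drawProb p f else 0) ≤
      Real.exp (-(p j * N / 10)) := by
  have h := chernoff_count (N := N) hp hp1 1 (2 * (p j * N)) j
  simp only [one_mul] at h
  refine h.trans (Real.exp_le_exp.2 ?_)
  have : 0 ≤ p j * N := mul_nonneg (hp j) N.cast_nonneg
  nlinarith [Real.exp_one_lt_d9]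

lemma sum_drawProb_count_lt {K N : ℕ} {p : Fin K → ℝ} (hp : ∀ k, 0 ≤ p k)
    (hp1 : ∑ k, p k = 1) (j : Fin K) :
    ∑ f : Fin N → Fin K, (if count f j < p j * N / 2 then drawProb p f else 0) ≤
      Real.exp (-(p j * N / 10)) := by
  have h := chernoff_count (N := N) hp hp1 (-1) (-(p j * N / 2)) j
  simp only [neg_one_mul, neg_lt_neg_iff] at h
  refine h.trans (Real.exp_le_exp.2 ?_)
  have : 0 ≤ p j * N := mul_nonneg (hp j) N.cast_nonneg
  nlinarith [Real.exp_neg_one_lt_d9]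

lemma sum_drawProb_count_eq_zero {K N : ℕ} {p : Fin K → ℝ} (hp1 : ∑ k, p k = 1) (k : Fin K) :
    ∑ f : Fin N → Fin K, (if count f k = 0 then drawProb p f else 0) = (1 - p k) ^ N := by
  have h := sum_drawProb_mul_prod (N := N) p fun i => if i = k then 0 else 1
  rw [sum_mul_ite_eq hp1] at h
  rw [show 1 - p k = 1 + p k * (0 - 1) by ring, ← h]
  refine Finset.sum_congr rfl fun f _ => ?_
  by_cases h0 : ∃ i, f i = k
  · obtain ⟨i, hi⟩ := h0
    rw [Finset.prod_eq_zero (Finset.mem_univ i) (by simp [hi]), mul_zero, if_neg]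
    simp only [count, Nat.cast_eq_zero, Finset.card_eq_zero]
    exact Finset.ne_empty_of_mem (by simp [hi] : i ∈ Finset.univ.filter fun i => f i = k)
  · push Not at h0
    simp [count, h0]

/-- Every feature occurs among the input tokens, and no feature occurs more than `ρ` times as
often as another one. -/
def Balanced {K N : ℕ} (ρ : ℝ) (f : Fin N → Fin K) : Prop :=
  (∀ j, 0 < count f j) ∧ ∀ i j, count f i ≤ ρ * count f j

open scoped Classical in
lemma sum_drawProb_not_balanced {K N : ℕ} {p : Fin K → ℝ} {c₁ c₂ : ℝ} (hc₁ : 0 < c₁)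
    (hK : 0 < K) (hN : 0 < N)
    (hp : ∀ k, c₁ / (K : ℝ) ≤ p k ∧ p k ≤ c₂ / (K : ℝ)) (hp1 : ∑ k, p k = 1) :
    ∑ f : Fin N → Fin K, (if Balanced (4 * c₂ / c₁) f then 0 else drawProb p f) ≤
      2 * K * Real.exp (-(c₁ / 10 * ((N : ℝ) / K))) := by
  have hK' : (0 : ℝ) < K := Nat.cast_pos.2 hK
  have hN' : (0 : ℝ) < N := Nat.cast_pos.2 hN
  have hp0 : ∀ k, 0 ≤ p k := fun k => (by positivity : 0 ≤ c₁ / (K : ℝ)).trans (hp k).1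
  calc ∑ f : Fin N → Fin K, (if Balanced (4 * c₂ / c₁) f then 0 else drawProb p f)
      ≤ ∑ f : Fin N → Fin K, ∑ j, ((if 2 * (p j * N) < count f j then drawProb p f else 0) +
          if count f j < p j * N / 2 then drawProb p f else 0) := by
        refine Finset.sum_le_sum fun f _ => ?_
        have h0 := drawProb_nonneg hp0 f
        have hterm : ∀ j, 0 ≤ (if 2 * (p j * N) < count f j then drawProb p f else 0) +
            if count f j < p j * N / 2 then drawProb p f else 0 := by
          intro j
          split_ifs <;> linarith
        split_ifs with hB
        · exact Finset.sum_nonneg fun j _ => hterm j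
        · have hex : ∃ j, 2 * (p j * N) < count f j ∨ count f j < p j * N / 2 := by
            by_contra hcon
            push Not at hcon
            apply hB
            have hlow : ∀ j, c₁ / K * N / 2 ≤ count f j := fun j =>
              le_trans (by have := (hp j).1; gcongr) (hcon j).2
            refine ⟨fun j => lt_of_lt_of_le (by positivity) (hlow j), fun i j => ?_⟩
            have hc₂ : 0 ≤ c₂ := by
              have := (hp0 i).trans (hp i).2
              rwa [le_div_iff₀ hK', zero_mul] at this
            calc count f i ≤ 2 * (c₂ / K * N) := (hcon i).1.trans (by have := (hp i).2; gcongr)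
              _ = 4 * c₂ / c₁ * (c₁ / K * N / 2) := by field_simp; ring
              _ ≤ _ := by gcongr; exact hlow j
          obtain ⟨j, hj⟩ := hex
          refine le_trans ?_ (Finset.single_le_sum (fun j _ => hterm j) (Finset.mem_univ j))
          rcases hj with hj | hj
          · rw [if_pos hj]; split_ifs <;> linarith
          · rw [if_pos hj]; split_ifs <;> linarith
    _ = ∑ j, (∑ f : Fin N → Fin K, (if 2 * (p j * N) < count f j then drawProb p f else 0) +
          ∑ f : Fin N → Fin K, if count f j < p j * N / 2 then drawProb p f else 0) := by
        rw [Finset.sum_comm]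
        simp only [Finset.sum_add_distrib]
    _ ≤ ∑ _j : Fin K, 2 * Real.exp (-(c₁ / 10 * ((N : ℝ) / K))) := by
        refine Finset.sum_le_sum fun j _ => ?_
        have hexp : Real.exp (-(p j * N / 10)) ≤ Real.exp (-(c₁ / 10 * ((N : ℝ) / K))) := by
          apply Real.exp_le_exp.2
          have : c₁ / K * N ≤ p j * N := by have := (hp j).1; gcongr
          have e : c₁ / 10 * ((N : ℝ) / K) = c₁ / K * N / 10 := by ring
          rw [e]; linarith
        linarith [sum_drawProb_count_gt (N := N) hp0 hp1 j, sum_drawProb_count_lt (N := N) hp0 hp1 j]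
    _ = _ := by simp; ring

/-! ### Estimates for a single attention distribution -/

section ProbabilityVector

variable {K : ℕ} {α : Fin K → ℝ}

lemma sum_erase_eq_one_sub (h1 : ∑ j, α j = 1) (k : Fin K) :
    ∑ j ∈ Finset.univ.erase k, α j = 1 - α k := by
  rw [← h1, ← Finset.sum_erase_add _ _ (Finset.mem_univ k)]
  ring

lemma prob_le_one (h0 : ∀ j, 0 ≤ α j) (h1 : ∑ j, α j = 1) (k : Fin K) : α k ≤ 1 :=
  h1 ▸ Finset.single_le_sum (fun j _ => h0 j) (Finset.mem_univ k)

lemma prob_le_one_sub (h0 : ∀ j, 0 ≤ α j) (h1 : ∑ j, α j = 1) {k n : Fin K} (hn : n ≠ k) :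
    α n ≤ 1 - α k := by
  rw [← sum_erase_eq_one_sub h1]
  exact Finset.single_le_sum (f := α) (fun j _ => h0 j) (by simp [hn])

lemma sum_erase_sq_nonneg (k : Fin K) : 0 ≤ ∑ j ∈ Finset.univ.erase k, α j ^ 2 :=
  Finset.sum_nonneg fun _ _ => sq_nonneg _

lemma sum_erase_sq_le (h0 : ∀ j, 0 ≤ α j) (h1 : ∑ j, α j = 1) {k : Fin K} {x : ℝ}
    (hx : ∀ n, n ≠ k → α n ≤ x) : ∑ j ∈ Finset.univ.erase k, α j ^ 2 ≤ x * (1 - α k) := by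
  rw [← sum_erase_eq_one_sub h1, Finset.mul_sum]
  refine Finset.sum_le_sum fun j hj => ?_
  rw [sq]
  exact mul_le_mul_of_nonneg_right (hx j (Finset.ne_of_mem_erase hj)) (h0 j)

lemma sum_err_sq_eq (k : Fin K) : ∑ j, (α j - if j = k then 1 else 0) ^ 2 =
    (1 - α k) ^ 2 + ∑ j ∈ Finset.univ.erase k, α j ^ 2 := by
  rw [← Finset.sum_erase_add _ _ (Finset.mem_univ k), add_comm]
  congr 1
  · simp; ring
  · exact Finset.sum_congr rfl fun j hj => by simp [Finset.ne_of_mem_erase hj]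

lemma sum_err_sq_le (h0 : ∀ j, 0 ≤ α j) (h1 : ∑ j, α j = 1) (k : Fin K) :
    ∑ j, (α j - if j = k then 1 else 0) ^ 2 ≤ 2 * (1 - α k) ^ 2 := by
  rw [sum_err_sq_eq]
  linarith [sum_erase_sq_le h0 h1 fun n hn => prob_le_one_sub (k := k) h0 h1 hn]

lemma sum_sq_eq (k : Fin K) : ∑ j, α j ^ 2 = α k ^ 2 + ∑ j ∈ Finset.univ.erase k, α j ^ 2 := by
  rw [← Finset.sum_erase_add _ _ (Finset.mem_univ k), add_comm]

lemma le_force_self (h0 : ∀ j, 0 ≤ α j) (k : Fin K) :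
    α k * (1 - α k) ^ 2 ≤ α k * ((if k = k then 1 else 0) - α k + ∑ j, α j ^ 2 - α k) := by
  refine mul_le_mul_of_nonneg_left ?_ (h0 k)
  rw [sum_sq_eq k, if_pos rfl]
  linarith [sum_erase_sq_nonneg (α := α) k]

lemma force_ne_eq {k n : Fin K} (hn : n ≠ k) :
    α n * ((if n = k then 1 else 0) - α n + ∑ j, α j ^ 2 - α k) =
      α n * (∑ j ∈ Finset.univ.erase k, α j ^ 2 - α k * (1 - α k) - α n) := by
  rw [sum_sq_eq k, if_neg hn]
  ring

lemma force_ne_le (h0 : ∀ j, 0 ≤ α j) (h1 : ∑ j, α j = 1) {k n : Fin K} (hn : n ≠ k) :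
    α n * ((if n = k then 1 else 0) - α n + ∑ j, α j ^ 2 - α k) ≤ (1 - α k) ^ 3 := by
  rw [force_ne_eq hn]
  have a := sum_erase_sq_le h0 h1 fun n hn => prob_le_one_sub (k := k) h0 h1 hn
  have b := prob_le_one_sub h0 h1 hn
  have c := prob_le_one h0 h1 k
  calc _ ≤ α n * ((1 - α k) * (1 - α k)) := by
        refine mul_le_mul_of_nonneg_left ?_ (h0 n)
        nlinarith [h0 k, h0 n]
    _ ≤ (1 - α k) * ((1 - α k) * (1 - α k)) :=
        mul_le_mul_of_nonneg_right b (mul_self_nonneg _)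
    _ = _ := by ring

lemma abs_force_ne_le_one (h0 : ∀ j, 0 ≤ α j) (h1 : ∑ j, α j = 1) {k n : Fin K} (hn : n ≠ k) :
    |α n * ((if n = k then 1 else 0) - α n + ∑ j, α j ^ 2 - α k)| ≤ 1 := by
  rw [force_ne_eq hn, abs_mul, abs_of_nonneg (h0 n)]
  have a := sum_erase_sq_le h0 h1 fun n hn => prob_le_one_sub (k := k) h0 h1 hn
  have a' := sum_erase_sq_nonneg (α := α) k
  have b := prob_le_one_sub h0 h1 hn
  have c := prob_le_one h0 h1 k
  have h : |∑ j ∈ Finset.univ.erase k, α j ^ 2 - α k * (1 - α k) - α n| ≤ 1 := by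
    rw [abs_le]
    constructor <;> nlinarith [h0 k, h0 n]
  exact mul_le_one₀ (by linarith [h0 k]) (abs_nonneg _) h

/-- If the attention off the feature `k` is spread evenly, the force on the logit of another
feature is a factor `κ` smaller than the force on the logit of `k`. -/
lemma abs_force_ne_le (h0 : ∀ j, 0 ≤ α j) (h1 : ∑ j, α j = 1) {k n : Fin K} (hn : n ≠ k)
    {κ M : ℝ} (hκ : ∀ n, n ≠ k → α n ≤ κ * (1 - α k)) (hκ0 : 0 ≤ κ) (hM : κ ≤ M * α k) :
    |α n * ((if n = k then 1 else 0) - α n + ∑ j, α j ^ 2 - α k)| ≤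
      κ * (1 + 2 * M) * (α k * (1 - α k) ^ 2) := by
  rw [force_ne_eq hn, abs_mul, abs_of_nonneg (h0 n)]
  have a := sum_erase_sq_le h0 h1 hκ
  have a' := sum_erase_sq_nonneg (α := α) k
  have c := prob_le_one h0 h1 k
  have c' : 0 ≤ 1 - α k := by linarith
  have d := hκ n hn
  have e : κ * (1 - α k) ≤ M * α k * (1 - α k) := mul_le_mul_of_nonneg_right hM c'
  have f : κ * (1 - α k) * (1 - α k) ≤ κ * (1 - α k) :=
    mul_le_of_le_one_right (mul_nonneg hκ0 c') (by linarith [h0 k])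
  have h : |∑ j ∈ Finset.univ.erase k, α j ^ 2 - α k * (1 - α k) - α n| ≤
      (1 + 2 * M) * (α k * (1 - α k)) := by
    have := mul_nonneg (h0 k) c'
    have := h0 n
    rw [abs_le]
    constructor <;> nlinarith
  calc _ ≤ κ * (1 - α k) * ((1 + 2 * M) * (α k * (1 - α k))) :=
        mul_le_mul d h (abs_nonneg _) (mul_nonneg hκ0 c')
    _ = _ := by ring

end ProbabilityVector

/-! ### Attention for balanced counts -/

section GroupAttn

variable {K : ℕ} {c b : Fin K → ℝ} {ρ : ℝ}

lemma groupAttn_nonneg (hc : ∀ j, 0 ≤ c j) (b : Fin K → ℝ) (j : Fin K) : 0 ≤ groupAttn c b j :=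
  div_nonneg (mul_nonneg (hc j) (Real.exp_pos _).le)
    (Finset.sum_nonneg fun m _ => mul_nonneg (hc m) (Real.exp_pos _).le)

lemma groupAttn_le_mul (hc : ∀ j, 0 ≤ c j) (hρ : ∀ i j, c i ≤ ρ * c j) {i j : Fin K} {s : ℝ}
    (hs : b i ≤ b j + s) : groupAttn c b i ≤ ρ * Real.exp s * groupAttn c b j := by
  rw [groupAttn, groupAttn, ← mul_div_assoc]
  refine div_le_div_of_nonneg_right ?_
    (Finset.sum_nonneg fun m _ => mul_nonneg (hc m) (Real.exp_pos _).le)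
  calc c i * Real.exp (b i) ≤ ρ * c j * Real.exp (b j + s) :=
        mul_le_mul (hρ i j) (Real.exp_le_exp.2 hs) (Real.exp_pos _).le ((hc i).trans (hρ i j))
    _ = _ := by rw [Real.exp_add]; ring

lemma sum_erase_const (k : Fin K) (x : ℝ) :
    ∑ _j ∈ Finset.univ.erase k, x = ((K : ℝ) - 1) * x := by
  have hK : 0 < K := k.pos
  rw [Finset.sum_const, Finset.card_erase_of_mem (Finset.mem_univ k), Finset.card_univ,
    Fintype.card_fin, nsmul_eq_mul, Nat.cast_sub hK, Nat.cast_one]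

lemma one_sub_groupAttn_le (hc : ∀ j, 0 ≤ c j) (hρ0 : 0 ≤ ρ) (hρ : ∀ i j, c i ≤ ρ * c j)
    (h1 : ∑ j, groupAttn c b j = 1) {k : Fin K} {D : ℝ} (hD : ∀ n, n ≠ k → D ≤ b k - b n) :
    1 - groupAttn c b k ≤ K * (ρ * Real.exp (-D)) := by
  have h0 := groupAttn_nonneg hc b
  rw [← sum_erase_eq_one_sub h1]
  calc ∑ j ∈ Finset.univ.erase k, groupAttn c b j
      ≤ ∑ _j ∈ Finset.univ.erase k, ρ * Real.exp (-D) := by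
        refine Finset.sum_le_sum fun j hj => ?_
        refine (groupAttn_le_mul (j := k) (s := -D) hc hρ ?_).trans ?_
        · linarith [hD j (Finset.ne_of_mem_erase hj)]
        · exact mul_le_of_le_one_right (by positivity) (prob_le_one h0 h1 k)
    _ ≤ _ := by
        rw [sum_erase_const]
        exact mul_le_mul_of_nonneg_right (by linarith) (by positivity)

lemma groupAttn_ne_le (hc : ∀ j, 0 ≤ c j) (hρ : ∀ i j, c i ≤ ρ * c j)
    (h1 : ∑ j, groupAttn c b j = 1) {k : Fin K} (hb : ∀ n, n ≠ k → |b n| ≤ 1) {n : Fin K}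
    (hn : n ≠ k) :
    ((K : ℝ) - 1) * groupAttn c b n ≤ ρ * Real.exp 2 * (1 - groupAttn c b k) := by
  rw [← sum_erase_eq_one_sub h1, Finset.mul_sum, ← sum_erase_const k]
  refine Finset.sum_le_sum fun j hj => groupAttn_le_mul hc hρ ?_
  have h := abs_le.1 (hb j (Finset.ne_of_mem_erase hj))
  have h' := abs_le.1 (hb n hn)
  linarith

lemma one_le_mul_groupAttn (hc : ∀ j, 0 ≤ c j) (hρ : ∀ i j, c i ≤ ρ * c j)
    (h1 : ∑ j, groupAttn c b j = 1) {k : Fin K} (hb : ∀ n, n ≠ k → |b n| ≤ 1)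
    (hk : 0 ≤ b k) : 1 ≤ K * (ρ * Real.exp 1 * groupAttn c b k) := by
  calc (1 : ℝ) = ∑ j, groupAttn c b j := h1.symm
    _ ≤ ∑ _j : Fin K, ρ * Real.exp 1 * groupAttn c b k := by
        refine Finset.sum_le_sum fun j _ => groupAttn_le_mul hc hρ ?_
        by_cases hj : j = k
        · subst hj; linarith
        · linarith [(abs_le.1 (hb j hj)).2]
    _ = _ := by simp

/-- As long as the competing logits are bounded and the logit of the query's own feature has not
reached `log (8 ρ K / √ε)`, the driving force has size at least of order `min (1 / K) ε`: it is at
least of order `1 / K` while less than half of the attention is on `k`, and afterwards the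
remaining attention `1 - α k` is still at least of order `√ε`. -/
lemma le_groupAttn_mul_sq (hK : 2 ≤ K) (hc : ∀ j, 0 ≤ c j) (hρ1 : 1 ≤ ρ)
    (hρ : ∀ i j, c i ≤ ρ * c j)
    (h1 : ∑ j, groupAttn c b j = 1) {k : Fin K} (hb : ∀ n, n ≠ k → |b n| ≤ 1)
    (hk : 0 ≤ b k) {ε : ℝ} (hε : 0 < ε)
    (hkε : Real.exp (b k) ≤ 8 * ρ * K / √ε) :
    1 / (2048 * ρ ^ 4 * Real.exp 2) * min (1 / (K : ℝ)) ε ≤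
      groupAttn c b k * (1 - groupAttn c b k) ^ 2 := by
  have hK' : (2 : ℝ) ≤ K := by exact_mod_cast hK
  have h0 := groupAttn_nonneg hc b
  have hk1 := prob_le_one h0 h1 k
  have he1 : (1 : ℝ) ≤ Real.exp 1 := Real.one_le_exp (by norm_num)
  have he2 : Real.exp 2 = Real.exp 1 ^ 2 := by rw [← Real.exp_nat_mul]; norm_num
  set α := groupAttn c b k
  set e := Real.exp 1
  rcases le_total α (1 / 2) with h | h
  · have hα : 1 / (K * (ρ * e)) ≤ α := by
      rw [div_le_iff₀ (by positivity)]
      linarith [one_le_mul_groupAttn hc hρ h1 hb hk]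
    have hsq : (1 / 4 : ℝ) ≤ (1 - α) ^ 2 := by nlinarith
    calc 1 / (2048 * ρ ^ 4 * Real.exp 2) * min (1 / (K : ℝ)) ε
        ≤ 1 / (4 * (ρ * e)) * (1 / K) := by
          refine mul_le_mul ?_ (min_le_left _ _) (by positivity) (by positivity)
          refine one_div_le_one_div_of_le (by positivity) ?_
          rw [he2]
          have a1 : ρ ≤ ρ ^ 4 := le_self_pow₀ hρ1 (by norm_num)
          have a2 : e ≤ e ^ 2 := le_self_pow₀ he1 (by norm_num)
          nlinarith [mul_le_mul a1 a2 (by positivity) (by positivity)]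
      _ = 1 / (K * (ρ * e)) * (1 / 4) := by field_simp
      _ ≤ _ := mul_le_mul hα hsq (by norm_num) (h0 k)
  · have hlow : √ε / (32 * ρ ^ 2 * e) ≤ 1 - α := by
      have hstep : ((K : ℝ) - 1) * α ≤ ρ * Real.exp (b k + 1) * (1 - α) := by
        rw [← sum_erase_eq_one_sub h1, Finset.mul_sum, ← sum_erase_const k]
        refine Finset.sum_le_sum fun j hj => groupAttn_le_mul hc hρ ?_
        linarith [(abs_le.1 (hb j (Finset.ne_of_mem_erase hj))).1]
      have hstep' : (K : ℝ) / 4 ≤ ρ * (8 * ρ * K / √ε * e) * (1 - α) := by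
        calc (K : ℝ) / 4 ≤ ((K : ℝ) - 1) * α := by nlinarith
          _ ≤ _ := hstep
          _ ≤ _ := by
            rw [Real.exp_add]
            have : 0 ≤ 1 - α := by linarith
            gcongr
      have hs : 0 < √ε := Real.sqrt_pos.2 hε
      rw [div_le_iff₀ (by positivity)]
      have e1 : ρ * (8 * ρ * K / √ε * e) * (1 - α) =
          (K : ℝ) / 4 * ((1 - α) * (32 * ρ ^ 2 * e) / √ε) := by field_simp; ring
      rw [e1] at hstep'
      rwa [le_mul_iff_one_le_right (by positivity), one_le_div hs] at hstep'
    calc 1 / (2048 * ρ ^ 4 * Real.exp 2) * min (1 / (K : ℝ)) ε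
        ≤ 1 / (2048 * ρ ^ 4 * Real.exp 2) * ε := by
          gcongr
          exact min_le_right _ _
      _ = 1 / 2 * (√ε / (32 * ρ ^ 2 * e)) ^ 2 := by
          rw [div_pow, Real.sq_sqrt hε.le, he2]
          field_simp
          norm_num
      _ ≤ _ := by gcongr

end GroupAttn

/-! ### The force on the logits -/

lemma groupAttn_count_nonneg {K N : ℕ} (f : Fin N → Fin K) (b : Fin K → ℝ) (j : Fin K) :
    0 ≤ groupAttn (count f) b j := groupAttn_nonneg (count_nonneg f) b j

lemma sum_groupAttn_count {K N : ℕ} (hN : 0 < N) (f : Fin N → Fin K) (b : Fin K → ℝ) :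
    ∑ j, groupAttn (count f) b j = 1 := sum_groupAttn (sum_count_mul_exp_pos hN f b).ne'

/-- The `drawProb`-probability that the counts are not balanced. -/
def unbalancedProb {K : ℕ} (p : Fin K → ℝ) (N : ℕ) (ρ : ℝ) : ℝ :=
  open scoped Classical in
  ∑ f : Fin N → Fin K, if Balanced ρ f then 0 else drawProb p f

lemma unbalancedProb_nonneg {K N : ℕ} {p : Fin K → ℝ} (hp : ∀ k, 0 ≤ p k) (ρ : ℝ) :
    0 ≤ unbalancedProb p N ρ := by
  unfold unbalancedProb
  refine Finset.sum_nonneg fun f _ => ?_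
  split_ifs
  · exact le_rfl
  · exact drawProb_nonneg hp f

open scoped Classical in
lemma sum_drawProb_balanced {K N : ℕ} {p : Fin K → ℝ} (hp1 : ∑ k, p k = 1) (ρ : ℝ) :
    ∑ f : Fin N → Fin K, (if Balanced ρ f then drawProb p f else 0) =
      1 - unbalancedProb p N ρ := by
  rw [unbalancedProb, ← sum_drawProb (N := N) hp1, ← Finset.sum_sub_distrib]
  refine Finset.sum_congr rfl fun f _ => ?_
  split_ifs <;> ring

/-- Comparing expectations on the balanced draws only costs the probability of the others. -/
lemma sum_drawProb_mul_le {K N : ℕ} {p : Fin K → ℝ} (hp : ∀ k, 0 ≤ p k) {ρ : ℝ}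
    {F G : (Fin N → Fin K) → ℝ} (hFG : ∀ f, Balanced ρ f → F f ≤ G f)
    (hF : ∀ f, F f ≤ 1) (hG : ∀ f, 0 ≤ G f) :
    ∑ f, drawProb p f * F f ≤ ∑ f, drawProb p f * G f + unbalancedProb p N ρ := by
  classical
  rw [unbalancedProb, ← Finset.sum_add_distrib]
  refine Finset.sum_le_sum fun f _ => ?_
  have h0 := drawProb_nonneg hp f
  split_ifs with h
  · linarith [mul_le_mul_of_nonneg_left (hFG f h) h0]
  · linarith [mul_le_mul_of_nonneg_left (hF f) h0, mul_nonneg h0 (hG f)]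

section Force

variable {K N : ℕ} {p : Fin K → ℝ} {ρ : ℝ} {b : Fin K → ℝ} {k : Fin K}

lemma sum_le_force_self (hp : ∀ k, 0 ≤ p k) :
    ∑ f : Fin N → Fin K,
      drawProb p f * (groupAttn (count f) b k * (1 - groupAttn (count f) b k) ^ 2) ≤
      force p N k b k :=
  Finset.sum_le_sum fun f _ => mul_le_mul_of_nonneg_left
    (le_force_self (groupAttn_count_nonneg f b) k) (drawProb_nonneg hp f)

lemma groupAttn_mul_sq_nonneg (f : Fin N → Fin K) (b : Fin K → ℝ) (k : Fin K) :
    0 ≤ groupAttn (count f) b k * (1 - groupAttn (count f) b k) ^ 2 :=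
  mul_nonneg (groupAttn_count_nonneg f b k) (sq_nonneg _)

lemma force_self_nonneg (hp : ∀ k, 0 ≤ p k) : 0 ≤ force p N k b k :=
  (Finset.sum_nonneg fun f _ =>
    mul_nonneg (drawProb_nonneg hp f) (groupAttn_mul_sq_nonneg f b k)).trans (sum_le_force_self hp)

lemma abs_force_le (hK : 2 ≤ K) (hN : 0 < N) (hp : ∀ k, 0 ≤ p k) (hρ1 : 1 ≤ ρ)
    (hb : ∀ n, n ≠ k → |b n| ≤ 1) (hk : 0 ≤ b k) {n : Fin K} (hn : n ≠ k) :
    |force p N k b n| ≤ ρ * Real.exp 2 / (K - 1) * (1 + 4 * ρ ^ 2 * Real.exp 3) *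
      force p N k b k + unbalancedProb p N ρ := by
  have hK' : (2 : ℝ) ≤ K := by exact_mod_cast hK
  have hK1 : (0 : ℝ) < K - 1 := by linarith
  set θ := ρ * Real.exp 2 / (K - 1) * (1 + 4 * ρ ^ 2 * Real.exp 3) with hθ
  have hθ0 : 0 ≤ θ := by positivity
  calc |force p N k b n| ≤ ∑ f : Fin N → Fin K, drawProb p f * |groupAttn (count f) b n *
        ((if n = k then 1 else 0) - groupAttn (count f) b n +
          ∑ j, groupAttn (count f) b j ^ 2 - groupAttn (count f) b k)| := by
        refine (Finset.abs_sum_le_sum_abs _ _).trans (Finset.sum_le_sum fun f _ => ?_)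
        rw [abs_mul, abs_of_nonneg (drawProb_nonneg hp f)]
    _ ≤ ∑ f : Fin N → Fin K, drawProb p f *
        (θ * (groupAttn (count f) b k * (1 - groupAttn (count f) b k) ^ 2)) +
          unbalancedProb p N ρ := by
        refine sum_drawProb_mul_le hp (fun f hf => ?_)
          (fun f => abs_force_ne_le_one (groupAttn_count_nonneg f b) (sum_groupAttn_count hN f b)
            hn) fun f => mul_nonneg hθ0 (groupAttn_mul_sq_nonneg f b k)
        have h0 := groupAttn_count_nonneg f b
        have h1 := sum_groupAttn_count hN f b
        have hlow := one_le_mul_groupAttn (count_nonneg f) hf.2 h1 hb hk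
        refine (abs_force_ne_le h0 h1 hn (κ := ρ * Real.exp 2 / (K - 1))
          (M := 2 * ρ ^ 2 * Real.exp 3) (fun m hm => ?_) (by positivity) ?_).trans_eq
          (by rw [hθ]; ring)
        · rw [div_mul_eq_mul_div, le_div_iff₀ hK1, mul_comm]
          exact groupAttn_ne_le (count_nonneg f) hf.2 h1 hb hm
        · rw [div_le_iff₀ hK1]
          have e3 : Real.exp 3 = Real.exp 2 * Real.exp 1 := by
            rw [← Real.exp_add]; norm_num
          rw [e3]
          calc ρ * Real.exp 2 ≤ ρ * Real.exp 2 *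
                (K * (ρ * Real.exp 1 * groupAttn (count f) b k)) :=
                le_mul_of_one_le_right (by positivity) hlow
            _ ≤ ρ * Real.exp 2 * ((2 * (K - 1)) * (ρ * Real.exp 1 * groupAttn (count f) b k)) := by
                have := h0 k
                gcongr
                linarith
            _ = _ := by ring
    _ ≤ _ := by
        have h := mul_le_mul_of_nonneg_left (sum_le_force_self (N := N) (b := b) (k := k) hp) hθ0
        rw [Finset.mul_sum] at h
        simp only [mul_left_comm (drawProb p _) θ]
        linarith

/-- Once half of the attention is on the right feature for balanced draws, the logit of every other
feature grows more slowly than the logit of the right one, up to the rare unbalanced draws. -/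
lemma force_le_force_self (hN : 0 < N) (hp : ∀ k, 0 ≤ p k)
    (hhalf : ∀ f : Fin N → Fin K, Balanced ρ f → 1 - groupAttn (count f) b k ≤ 1 / 2)
    {n : Fin K} (hn : n ≠ k) :
    force p N k b n ≤ force p N k b k + unbalancedProb p N ρ := by
  refine le_trans (sum_drawProb_mul_le (ρ := ρ) hp
    (G := fun f => groupAttn (count f) b k * (1 - groupAttn (count f) b k) ^ 2)
    (fun f hf => ?_) (fun f => ?_) fun f => groupAttn_mul_sq_nonneg f b k)
    (add_le_add_left (sum_le_force_self hp) _)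
  · refine (force_ne_le (groupAttn_count_nonneg f b) (sum_groupAttn_count hN f b) hn).trans ?_
    rw [pow_succ']
    exact mul_le_mul_of_nonneg_right (by linarith [hhalf f hf]) (sq_nonneg _)
  · exact (abs_le.1 (abs_force_ne_le_one (groupAttn_count_nonneg f b)
      (sum_groupAttn_count hN f b) hn)).2

lemma le_force_self_of_lt (hK : 2 ≤ K) (hN : 0 < N) (hp : ∀ k, 0 ≤ p k) (hp1 : ∑ k, p k = 1)
    (hρ1 : 1 ≤ ρ) (hb : ∀ n, n ≠ k → |b n| ≤ 1) (hk : 0 ≤ b k) {ε : ℝ} (hε : 0 < ε)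
    (hkε : Real.exp (b k) ≤ 8 * ρ * K / √ε) (hδ : unbalancedProb p N ρ ≤ 1 / 2) :
    1 / (4096 * ρ ^ 4 * Real.exp 2) * min (1 / (K : ℝ)) ε ≤ force p N k b k := by
  classical
  set r := 1 / (2048 * ρ ^ 4 * Real.exp 2) * min (1 / (K : ℝ)) ε with hr
  have hr0 : 0 ≤ r := by positivity
  calc 1 / (4096 * ρ ^ 4 * Real.exp 2) * min (1 / (K : ℝ)) ε = 1 / 2 * r := by
        rw [hr]; field_simp; norm_num
    _ ≤ (∑ f : Fin N → Fin K, if Balanced ρ f then drawProb p f else 0) * r := by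
        rw [sum_drawProb_balanced hp1]
        exact mul_le_mul_of_nonneg_right (by linarith) hr0
    _ ≤ ∑ f : Fin N → Fin K,
      drawProb p f * (groupAttn (count f) b k * (1 - groupAttn (count f) b k) ^ 2) := by
        rw [Finset.sum_mul]
        refine Finset.sum_le_sum fun f _ => ?_
        have h0 := drawProb_nonneg hp f
        split_ifs with hf
        · exact mul_le_mul_of_nonneg_left (le_groupAttn_mul_sq hK (count_nonneg f) hρ1 hf.2
            (sum_groupAttn_count hN f b) hb hk hε hkε) h0
        · rw [zero_mul]
          exact mul_nonneg h0 (groupAttn_mul_sq_nonneg f b k)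
    _ ≤ _ := sum_le_force_self hp

end Force

/-! ### The dynamics of the logits of one query -/

section Dynamics

variable {K N : ℕ} {p : Fin K → ℝ} {ρ : ℝ} {k : Fin K}

/-- If the logit of `k` leads all others by `A - 1`, where `e ^ A = 8 ρ K / √ε`, then at most
`√ε / 2` of the attention is on the wrong features. -/
lemma one_sub_groupAttn_le_sqrt (hN : 0 < N) (hρ1 : 1 ≤ ρ) {ε A : ℝ} (hε : 0 < ε)
    (hA : Real.exp A = 8 * ρ * K / √ε) {b : Fin K → ℝ} (hb : ∀ n, n ≠ k → A - 1 ≤ b k - b n)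
    {f : Fin N → Fin K} (hf : Balanced ρ f) :
    1 - groupAttn (count f) b k ≤ √ε / 2 := by
  have hK : (0 : ℝ) < K := Nat.cast_pos.2 k.pos
  have hs := Real.sqrt_pos.2 hε
  refine (one_sub_groupAttn_le (count_nonneg f) (by linarith) hf.2
    (sum_groupAttn_count hN f b) hb).trans ?_
  rw [neg_sub, Real.exp_sub, hA]
  have e : K * (ρ * (Real.exp 1 / (8 * ρ * K / √ε))) = Real.exp 1 / 8 * √ε := by field_simp
  rw [e]
  nlinarith [Real.exp_one_lt_d9]

/-- Gradient descent on the logits of the query `k` with effective learning rate `γ`. While the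
logit of `k` is below `A`, it grows at the rate `r`, and the other logits move by at most a
fraction `φ` of its growth. Once it has passed `A`, its lead over every other logit can only be
reduced by the unbalanced draws. -/
theorem lead_of_steps (hK : 2 ≤ K) (hN : 0 < N) (hp : ∀ k, 0 ≤ p k) (hp1 : ∑ k, p k = 1)
    (hρ1 : 1 ≤ ρ) {ε A θ r γ : ℝ} (hε : 0 < ε) (hε1 : ε < 1) (hγ : 0 < γ)
    (hA : Real.exp A = 8 * ρ * K / √ε)
    (hθ : θ = ρ * Real.exp 2 / (K - 1) * (1 + 4 * ρ ^ 2 * Real.exp 3))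
    (hr : r = 1 / (4096 * ρ ^ 4 * Real.exp 2) * min (1 / (K : ℝ)) ε)
    (hθA : 2 * θ * A ≤ 1 / 2) (hδ : unbalancedProb p N ρ ≤ 1 / 2)
    (hδr : unbalancedProb p N ρ ≤ θ * r) {T : ℕ} (hT : A ≤ T * (γ * r))
    (hTδ : ((T : ℝ) - 1) * (γ * unbalancedProb p N ρ) ≤ 1 / 2)
    {b : ℕ → Fin K → ℝ} (hb0 : ∀ n, b 0 n = 0)
    (hb : ∀ t n, b (t + 1) n = b t n + γ * force p N k (b t) n) {n : Fin K} (hn : n ≠ k) :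
    A - 1 ≤ b T k - b T n := by
  have hK' : (2 : ℝ) ≤ K := by exact_mod_cast hK
  have hs := Real.sqrt_pos.2 hε
  have hs1 : √ε ≤ 1 := Real.sqrt_le_one.2 hε1.le
  have hθ0 : 0 ≤ θ := by
    have : (0 : ℝ) < K - 1 := by linarith
    rw [hθ]; positivity
  have hδ0 : 0 ≤ unbalancedProb p N ρ := unbalancedProb_nonneg hp ρ
  have hA0 : 0 < A := by
    rw [← Real.exp_lt_exp, hA, Real.exp_zero, one_lt_div hs]
    nlinarith
  set δ := unbalancedProb p N ρ
  have key : ∀ t : ℕ, t ≤ T →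
      (b t k < A ∧ t * (γ * r) ≤ b t k ∧ ∀ n, n ≠ k → |b t n| ≤ 2 * θ * b t k) ∨
      (1 ≤ t ∧ ∀ n, n ≠ k → A - 1 / 2 - ((t : ℝ) - 1) * (γ * δ) ≤ b t k - b t n) := by
    intro t
    induction t with
    | zero =>
      intro _
      left
      simp [hb0, hA0]
    | succ t ih =>
      intro htT
      have hforce := force_self_nonneg (N := N) (k := k) (b := b t) hp
      rcases ih (by omega) with ⟨hlt, hgrow, hsmall⟩ | ⟨ht1, hlead⟩
      · have hr0 : 0 ≤ r := by rw [hr]; positivity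
        have hbk0 : 0 ≤ b t k := le_trans (by positivity) hgrow
        have hsmall1 : ∀ n, n ≠ k → |b t n| ≤ 1 := fun n hn => by
          have : 2 * θ * b t k ≤ 2 * θ * A := by gcongr
          linarith [hsmall n hn]
        have hrF : r ≤ force p N k (b t) k := by
          rw [hr]
          exact le_force_self_of_lt hK hN hp hp1 hρ1 hsmall1 hbk0 hε
            ((Real.exp_le_exp.2 hlt.le).trans_eq hA) hδ
        have hsmall' : ∀ n, n ≠ k → |b (t + 1) n| ≤ 2 * θ * b (t + 1) k := by
          intro n hn
          have h1 := abs_force_le hK hN hp hρ1 hsmall1 hbk0 hn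
          rw [← hθ] at h1
          have h2 : |force p N k (b t) n| ≤ 2 * θ * force p N k (b t) k := by
            linarith [mul_le_mul_of_nonneg_left hrF hθ0]
          rw [hb, hb]
          calc _ ≤ |b t n| + γ * |force p N k (b t) n| := by
                refine (abs_add_le _ _).trans_eq ?_
                rw [abs_mul, abs_of_pos hγ]
            _ ≤ 2 * θ * b t k + γ * (2 * θ * force p N k (b t) k) := by
                gcongr
                exact hsmall n hn
            _ = _ := by ring
        rcases lt_or_ge (b (t + 1) k) A with h | h
        · left
          refine ⟨h, ?_, hsmall'⟩
          rw [hb]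
          push_cast
          linarith [mul_le_mul_of_nonneg_left hrF hγ.le]
        · right
          refine ⟨by omega, fun n hn => ?_⟩
          have h1 := (abs_le.1 (hsmall' n hn)).2
          -- `2 θ ≤ 1`, as `2 θ A ≤ 1 / 2` with `A ≥ 1 / 2`
          have hA1 : 1 / 2 ≤ A := by
            have : (1 : ℝ) + 1 ≤ Real.exp A := by
              rw [hA, le_div_iff₀ hs]
              nlinarith
            by_contra hcon
            push Not at hcon
            have h3 := Real.exp_le_exp.2 hcon.le
            have h4 : Real.exp (1 / 2) ^ 2 = Real.exp 1 := by
              rw [← Real.exp_nat_mul]; norm_num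
            nlinarith [Real.exp_one_lt_d9]
          have h2 : 0 ≤ (1 - 2 * θ) * (b (t + 1) k - A) :=
            mul_nonneg (by nlinarith) (by linarith)
          have h3 : 0 ≤ (t : ℝ) * (γ * δ) := by positivity
          push_cast
          linarith
      · right
        refine ⟨by omega, fun n hn => ?_⟩
        have hdrift : ((t : ℝ) - 1) * (γ * δ) ≤ 1 / 2 := by
          refine le_trans ?_ hTδ
          have : (t : ℝ) ≤ T := by exact_mod_cast (by omega : t ≤ T)
          gcongr
        have hF := force_le_force_self (ρ := ρ) (b := b t) (k := k) hN hp (fun f hf => by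
          have := one_sub_groupAttn_le_sqrt (k := k) (b := b t) hN hρ1 hε hA
            (fun n hn => by linarith [hlead n hn]) hf
          linarith) hn
        have h1 := hlead n hn
        rw [hb, hb]
        push_cast
        linarith [mul_le_mul_of_nonneg_left hF hγ.le]
  rcases key T le_rfl with ⟨hlt, hgrow, -⟩ | ⟨-, hlead⟩
  · linarith
  · linarith [hlead n hn]

end Dynamics

/-! ### The optimal loss -/

lemma sum_mul_le_of_le {K : ℕ} {p φ : Fin K → ℝ} {x : ℝ} (hp : ∀ k, 0 ≤ p k)
    (hp1 : ∑ k, p k = 1) (h : ∀ k, φ k ≤ x) : ∑ k, p k * φ k ≤ x := by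
  calc ∑ k, p k * φ k ≤ ∑ k, p k * x :=
        Finset.sum_le_sum fun k _ => mul_le_mul_of_nonneg_left (h k) (hp k)
    _ = x := by rw [← Finset.sum_mul, hp1, one_mul]

lemma le_sum_mul_of_le {K : ℕ} {p φ : Fin K → ℝ} {x : ℝ} (hp : ∀ k, 0 ≤ p k)
    (hp1 : ∑ k, p k = 1) (h : ∀ k, x ≤ φ k) : x ≤ ∑ k, p k * φ k := by
  calc x = ∑ k, p k * x := by rw [← Finset.sum_mul, hp1, one_mul]
    _ ≤ _ := Finset.sum_le_sum fun k _ => mul_le_mul_of_nonneg_left (h k) (hp k)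

/-- When the feature `k` is absent from the prompt, the squared error is at least `1`. -/
lemma pow_le_queryLoss {K N : ℕ} {p : Fin K → ℝ} (hp : ∀ k, 0 ≤ p k) (hp1 : ∑ k, p k = 1)
    (k : Fin K) (b : Fin K → ℝ) : (1 - p k) ^ N ≤ queryLoss p N k b := by
  rw [← sum_drawProb_count_eq_zero hp1, queryLoss]
  refine Finset.sum_le_sum fun f _ => ?_
  have h0 := drawProb_nonneg hp f
  split_ifs with h
  · refine le_mul_of_one_le_right h0 ?_
    rw [sum_err_sq_eq]
    have hα : groupAttn (count f) b k = 0 := by simp [groupAttn, h]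
    rw [hα]
    linarith [sum_erase_sq_nonneg (α := groupAttn (count f) b) k]
  · positivity

lemma loss_nonneg {d K : ℕ} (μ : Measure (Token d)) (v : Fin K → Token d) (p : Fin K → ℝ)
    (N : ℕ) (Q : Param d) : 0 ≤ loss μ v p N Q :=
  mul_nonneg (by norm_num) (integral_nonneg fun _ => sq_nonneg _)

lemma bddBelow_range_loss {d K : ℕ} (μ : Measure (Token d)) (v : Fin K → Token d)
    (p : Fin K → ℝ) (N : ℕ) : BddBelow (Set.range fun Q => loss μ v p N Q) :=
  ⟨0, by rintro _ ⟨Q, rfl⟩; exact loss_nonneg μ v p N Q⟩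

section Optimum

variable {d K N : ℕ} {μ : Measure (Token d)} {v : Fin K → Token d} {p : Fin K → ℝ}

theorem exp_le_optLoss (hμ : IsTaskDist μ) (hv : Orthonormal ℝ v) (hp : ∀ k, 0 ≤ p k)
    (hp1 : ∑ k, p k = 1) {q : ℝ} (hpq : ∀ k, p k ≤ q) (hq : q ≤ 1 / 2) :
    1 / 2 * Real.exp (-(2 * q * N)) ≤ optLoss μ v p N := by
  refine le_ciInf fun Q => ?_
  rw [loss_eq hμ hv hp]
  refine le_sum_mul_of_le hp hp1 fun k => mul_le_mul_of_nonneg_left ?_ (by norm_num)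
  refine le_trans ?_ (pow_le_queryLoss hp hp1 k _)
  rw [show -(2 * q * N) = (N : ℝ) * (-(2 * q)) by ring, Real.exp_nat_mul]
  refine pow_le_pow_left₀ (Real.exp_pos _).le ?_ N
  have hq0 : 0 ≤ q := (hp k).trans (hpq k)
  -- `(1 - q) (1 + 2 q) ≥ 1` for `0 ≤ q ≤ 1 / 2`
  have h1 : Real.exp (-(2 * q)) * (1 + 2 * q) ≤ 1 := by
    have h := Real.add_one_le_exp (2 * q)
    calc _ ≤ Real.exp (-(2 * q)) * Real.exp (2 * q) := by gcongr; linarith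
      _ = 1 := by rw [← Real.exp_add]; simp
  have h2 : 1 ≤ (1 - q) * (1 + 2 * q) := by nlinarith
  have h3 : Real.exp (-(2 * q)) ≤ 1 - q :=
    le_of_mul_le_mul_right (h1.trans h2) (by linarith)
  linarith [hpq k]

/-- Attention on the wrong features when the logit of the query's own feature is `s` and all
others vanish. -/
lemma one_sub_groupAttn_single_le {s : ℝ} (hN : 0 < N) (f : Fin N → Fin K) (k : Fin K)
    (hk : count f k ≠ 0) :
    1 - groupAttn (count f) (fun n => if n = k then s else 0) k ≤ N * Real.exp (-s) := by
  set b : Fin K → ℝ := fun n => if n = k then s else 0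
  have hk1 : 1 ≤ count f k := by
    rw [count, Nat.one_le_cast]
    exact Nat.one_le_iff_ne_zero.2 fun h => hk (by rw [count, h, Nat.cast_zero])
  have hZ := sum_count_mul_exp_pos hN f b
  rw [groupAttn, one_sub_div hZ.ne', div_le_iff₀ hZ]
  have hsplit : ∑ m, count f m * Real.exp (b m) - count f k * Real.exp (b k) =
      ∑ m ∈ Finset.univ.erase k, count f m := by
    rw [← Finset.sum_erase_add _ _ (Finset.mem_univ k), add_sub_cancel_right]
    exact Finset.sum_congr rfl fun m hm => by simp [b, Finset.ne_of_mem_erase hm]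
  have hle : Real.exp s ≤ ∑ m, count f m * Real.exp (b m) := by
    refine le_trans ?_ (Finset.single_le_sum
      (fun m _ => mul_nonneg (count_nonneg f m) (Real.exp_pos _).le) (Finset.mem_univ k))
    simpa [b] using le_mul_of_one_le_left (Real.exp_pos s).le hk1
  calc _ = ∑ m ∈ Finset.univ.erase k, count f m := hsplit
    _ ≤ ∑ m, count f m := Finset.sum_le_sum_of_subset_of_nonneg (Finset.erase_subset _ _)
        fun m _ _ => count_nonneg f m
    _ = N * Real.exp (-s) * Real.exp s := by
        rw [sum_count, mul_assoc, ← Real.exp_add]; simp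
    _ ≤ _ := by gcongr

/-- The parameter `s ∑ v_k v_kᵀ` with a large `s` is nearly optimal: it errs essentially only when
the feature of the query is absent from the prompt. -/
theorem optLoss_le_exp (hμ : IsTaskDist μ) (hv : Orthonormal ℝ v) (hp1 : ∑ k, p k = 1)
    {q : ℝ} (hN : 0 < N) (hq0 : 0 ≤ q) (hqp : ∀ k, q ≤ p k) (hq : q ≤ 1) :
    optLoss μ v p N ≤ 2 * Real.exp (-(q * N)) := by
  have hp : ∀ k, 0 ≤ p k := fun k => hq0.trans (hqp k)
  have hN' : (0 : ℝ) < N := Nat.cast_pos.2 hN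
  set s : ℝ := Real.log N + N with hs
  set Q : Param d := ∑ k, s • outer (v k) (v k) with hQ
  have hlogit : ∀ n k, logit Q (v n) (v k) = if n = k then s else 0 := by
    intro n k
    rw [← inner_outer, hQ]
    simp only [inner_sum, inner_smul_right, inner_outer, logit_outer, orthonormal_iff_ite.1 hv]
    simp [eq_comm]
  refine (ciInf_le (bddBelow_range_loss μ v p N) Q).trans ?_
  rw [loss_eq hμ hv hp]
  refine sum_mul_le_of_le hp hp1 fun k => ?_
  simp only [hlogit]
  have hexp : (N : ℝ) * Real.exp (-s) = Real.exp (-N) := by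
    rw [hs, neg_add, Real.exp_add, Real.exp_neg (Real.log N), Real.exp_log hN']
    field_simp
  have hbound : queryLoss p N k (fun n => if n = k then s else 0) ≤
      2 * ((1 - p k) ^ N + Real.exp (-N)) := by
    rw [← sum_drawProb_count_eq_zero hp1]
    calc queryLoss p N k (fun n => if n = k then s else 0)
        ≤ ∑ f : Fin N → Fin K, 2 * ((if count f k = 0 then drawProb p f else 0) +
            drawProb p f * Real.exp (-N)) := by
          refine Finset.sum_le_sum fun f _ => ?_
          have h0 := drawProb_nonneg hp f
          have hα0 := groupAttn_count_nonneg f (fun n => if n = k then s else 0)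
          have hα1 := sum_groupAttn_count hN f (fun n => if n = k then s else 0)
          have h1 := sum_err_sq_le hα0 hα1 k
          have hx := hα0 k
          have hx1 := prob_le_one hα0 hα1 k
          set x := groupAttn (count f) (fun n => if n = k then s else 0) k with hxdef
          refine (mul_le_mul_of_nonneg_left h1 h0).trans ?_
          have he := Real.exp_pos (-(N : ℝ))
          split_ifs with h
          · have : (1 - x) ^ 2 ≤ 1 := by nlinarith
            nlinarith [mul_nonneg h0 he.le]
          · have h2 : 1 - x ≤ Real.exp (-N) := by
              rw [← hexp]
              exact one_sub_groupAttn_single_le hN f k h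
            have : (1 - x) ^ 2 ≤ Real.exp (-N) := by nlinarith
            nlinarith
      _ = _ := by
          rw [← Finset.mul_sum, Finset.sum_add_distrib, ← Finset.sum_mul, sum_drawProb hp1,
            one_mul]
  have h1 : (1 - p k) ^ N ≤ Real.exp (-(q * N)) := by
    rw [show -(q * N) = (N : ℝ) * (-q) by ring, Real.exp_nat_mul]
    have hpk : p k ≤ 1 := hp1 ▸ Finset.single_le_sum (fun k _ => hp k) (Finset.mem_univ k)
    refine pow_le_pow_left₀ (by linarith) ?_ N
    linarith [Real.add_one_le_exp (-q), hqp k]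
  have h2 : Real.exp (-(N : ℝ)) ≤ Real.exp (-(q * N)) :=
    Real.exp_le_exp.2 (by nlinarith)
  linarith

/-- If for balanced draws all but `x` of the attention is on the right feature, the loss is at most
`x ^ 2` up to the unbalanced draws. -/
lemma loss_le_of_balanced (hμ : IsTaskDist μ) (hv : Orthonormal ℝ v) (hp : ∀ k, 0 ≤ p k)
    (hp1 : ∑ k, p k = 1) (hN : 0 < N) {Q : Param d} {ρ x : ℝ}
    (hx : ∀ k, ∀ f : Fin N → Fin K, Balanced ρ f →
      1 - groupAttn (count f) (fun n => logit Q (v n) (v k)) k ≤ x) :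
    loss μ v p N Q ≤ x ^ 2 + unbalancedProb p N ρ := by
  rw [loss_eq hμ hv hp]
  refine sum_mul_le_of_le hp hp1 fun k => ?_
  set b : Fin K → ℝ := fun n => logit Q (v n) (v k)
  have hα0 := fun f : Fin N → Fin K => groupAttn_count_nonneg f b
  have hα1 := fun f : Fin N → Fin K => sum_groupAttn_count hN f b
  have h1 : queryLoss p N k b ≤
      2 * ∑ f : Fin N → Fin K, drawProb p f * (1 - groupAttn (count f) b k) ^ 2 := by
    rw [queryLoss, Finset.mul_sum]
    refine Finset.sum_le_sum fun f _ => ?_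
    linarith [mul_le_mul_of_nonneg_left (sum_err_sq_le (hα0 f) (hα1 f) k) (drawProb_nonneg hp f)]
  have h2 := sum_drawProb_mul_le (N := N) (ρ := ρ) hp
    (F := fun f => (1 - groupAttn (count f) b k) ^ 2) (G := fun _ => x ^ 2)
    (fun f hf => pow_le_pow_left₀ (by linarith [prob_le_one (hα0 f) (hα1 f) k]) (hx k f hf) 2)
    (fun f => by nlinarith [prob_le_one (hα0 f) (hα1 f) k, hα0 f k]) fun _ => sq_nonneg x
  rw [← Finset.sum_mul, sum_drawProb hp1, one_mul] at h2
  linarith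

lemma le_inputDist_real (hv : Orthonormal ℝ v) (hp : ∀ k, 0 ≤ p k) (hp1 : ∑ k, p k = 1)
    {Q : Param d} {ρ y : ℝ} {k : Fin K}
    (hy : ∀ f : Fin N → Fin K, Balanced ρ f →
      (1 - groupAttn (count f) (fun n => logit Q (v n) (v k)) k) ^ 2 ≤ y) :
    1 - unbalancedProb p N ρ ≤
      (inputDist v p N).real {X | (1 - featureAttn Q v X (v k) k) ^ 2 ≤ y} := by
  classical
  rw [inputDist_real v hp, ← sum_drawProb_balanced hp1]
  refine Finset.sum_le_sum fun f _ => ?_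
  have h0 := drawProb_nonneg hp f
  by_cases hf : Balanced ρ f
  · rw [if_pos hf, if_pos]
    rw [Set.mem_ofPred_eq, featureAttn_eq Q hv.linearIndependent.injective]
    exact hy f hf
  · rw [if_neg hf]
    split_ifs <;> simp [h0]

end Optimum

/-! ### The choice of the constants -/

lemma exists_nat_threshold (M B : ℝ) (a : ℕ) :
    ∃ K₀ : ℕ, ∀ K : ℕ, K₀ ≤ K →
      M ≤ K ∧ B * (2 * Real.log K + Real.log K ^ a) ≤ K := by
  have h1 : (fun x : ℝ => B * (2 * Real.log x + Real.log x ^ a)) =o[Filter.atTop] fun x => x := by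
    refine Asymptotics.IsLittleO.const_mul_left (Asymptotics.IsLittleO.add ?_ ?_) B
    · exact Real.isLittleO_log_id_atTop.const_mul_left 2
    · exact Real.isLittleO_pow_log_id_atTop
  have h2 := (h1.bound one_pos).and (Filter.eventually_ge_atTop (max M 0))
  obtain ⟨K₀, hK₀⟩ := Filter.eventually_atTop.1 (tendsto_natCast_atTop_atTop.eventually h2)
  refine ⟨K₀, fun K hK => ?_⟩
  obtain ⟨h3, h4⟩ := hK₀ K hK
  refine ⟨(le_max_left _ _).trans h4, (le_abs_self _).trans ?_⟩
  simpa using h3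

/-- The time needed at the rate `min (1 / K) ε / K` to reach the level `u + w`, where `u = log K`
and `w = log (1 / ε) / 2`. -/
lemma add_le_time_mul_min {K ε u w : ℝ} (hK : 0 < K) (hε : 0 < ε) (hε1 : ε < 1)
    (hu : u = Real.log K) (hu0 : 0 ≤ u) (hw : w = -(1 / 2) * Real.log ε) :
    (u + w) / 2 ≤ (K ^ 2 * u + K * (u + w) / ε) * (min (1 / K) ε / K) := by
  have hw0 : 0 ≤ w := by
    have := Real.log_neg hε hε1
    rw [hw]; linarith
  rcases le_total (1 / K) ε with h | h
  · rw [min_eq_left h]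
    have hlog : -Real.log ε ≤ u := by
      rw [hu, ← Real.log_inv]
      refine Real.log_le_log (by positivity) ?_
      rw [inv_le_comm₀ hε hK, ← one_div]
      exact h
    have e : (K ^ 2 * u + K * (u + w) / ε) * (1 / K / K) = u + (u + w) / (K * ε) := by
      field_simp
    rw [e]
    have : 0 ≤ (u + w) / (K * ε) := by positivity
    linarith
  · rw [min_eq_right h]
    have e : (K ^ 2 * u + K * (u + w) / ε) * (ε / K) = K * u * ε + (u + w) := by
      field_simp
    rw [e]
    have : 0 ≤ K * u * ε := by positivity
    linarith

lemma mul_exp_neg_mul_sq_le {K c x : ℝ} (hc : 0 < c) (hK : 4 ≤ K) (hKc : 1 ≤ c * K)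
    (hx : K ^ 2 ≤ x) :
    2 * K * Real.exp (-(2 * c * x)) ≤ Real.exp (-(c * x)) := by
  have h1 : 2 * K ≤ Real.exp K := by nlinarith [Real.quadratic_le_exp_of_nonneg (by linarith : 0 ≤ K)]
  have h2 : K ≤ c * x := by nlinarith
  calc 2 * K * Real.exp (-(2 * c * x)) ≤ Real.exp (c * x) * Real.exp (-(2 * c * x)) := by
        gcongr
        exact h1.trans (Real.exp_le_exp.2 h2)
    _ = _ := by rw [← Real.exp_add]; congr 1; ring

/-- Over the whole learning time the unbalanced draws shift the logits only by a constant. -/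
lemma time_mul_le_half {K C ε u w δ : ℝ} (hK0 : 0 < K) (hC0 : 0 < C) (hKC : 6 * C ≤ K)
    (hu0 : 0 ≤ u) (huK : u ≤ K) (huw0 : 0 ≤ u + w) (huwK : 2 * (u + w) ≤ K)
    (hεexp : Real.exp (-K) ≤ ε) (hδ : δ ≤ Real.exp (-(10 * K))) :
    C * (K ^ 2 * u + K * (u + w) / ε) * δ ≤ 1 / 2 := by
  have hε : 0 < ε := (Real.exp_pos _).trans_le hεexp
  have hKexp : K ≤ Real.exp K := by linarith [Real.add_one_le_exp K]
  set H := C * (K ^ 2 * u + K * (u + w) / ε) with hH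
  have hH0 : 0 ≤ H := by positivity
  have h1 : H ≤ C * (3 * Real.exp (3 * K)) := by
    have e3 : Real.exp (3 * K) = Real.exp K ^ 2 * Real.exp K := by
      rw [← pow_succ, ← Real.exp_nat_mul]; norm_num
    have hinv : 1 / ε ≤ Real.exp K := by
      rw [one_div, inv_le_comm₀ hε (Real.exp_pos _), ← Real.exp_neg]
      exact hεexp
    have a1 : K ^ 2 * u ≤ Real.exp K ^ 2 * Real.exp K := by
      gcongr
      linarith
    have a2 : K * (u + w) / ε ≤ Real.exp K ^ 2 * Real.exp K := by
      rw [div_eq_mul_one_div, sq]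
      gcongr
      linarith
    rw [hH, e3]
    gcongr
    linarith [Real.exp_pos K, pow_pos (Real.exp_pos K) 2,
      mul_pos (pow_pos (Real.exp_pos K) 2) (Real.exp_pos K)]
  have hδ0 : (0 : ℝ) ≤ Real.exp (-(10 * K)) := (Real.exp_pos _).le
  calc H * δ ≤ C * (3 * Real.exp (3 * K)) * Real.exp (-(10 * K)) :=
        mul_le_mul_of_nonneg h1 hδ hH0 hδ0
    _ = C * 3 * Real.exp (-(7 * K)) := by
        rw [mul_assoc, mul_assoc, ← Real.exp_add, ← mul_assoc]
        congr 2; ring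
    _ ≤ C * 3 * Real.exp (-K) := by
        gcongr
        linarith
    _ ≤ 1 / 2 := by
        rw [Real.exp_neg, ← div_eq_mul_inv, div_le_iff₀ (Real.exp_pos _)]
        linarith

lemma exp_neg_le_rate {K ρ : ℝ} (hρ1 : 1 ≤ ρ) (hKρ : 1024 * ρ ≤ K) :
    Real.exp (-(8 * K)) ≤ 1 / (4096 * ρ ^ 4 * Real.exp 2) := by
  have hKexp : K ≤ Real.exp K := by linarith [Real.add_one_le_exp K]
  have e4 : Real.exp (8 * K) = Real.exp K ^ 4 * Real.exp K ^ 4 := by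
    rw [← pow_add, ← Real.exp_nat_mul]; norm_num
  have a1 : ρ ^ 4 ≤ Real.exp K ^ 4 := by
    gcongr
    linarith
  have a2 : 4096 ≤ Real.exp K ^ 2 := by
    have : (64 : ℝ) ≤ Real.exp K := by linarith
    nlinarith
  have a3 : Real.exp 2 ≤ Real.exp K ^ 2 := by
    rw [← Real.exp_nat_mul]
    apply Real.exp_le_exp.2
    push_cast
    linarith
  rw [Real.exp_neg, ← one_div, e4]
  refine one_div_le_one_div_of_le (by positivity) ?_
  calc 4096 * ρ ^ 4 * Real.exp 2 ≤ Real.exp K ^ 2 * Real.exp K ^ 4 * Real.exp K ^ 2 := by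
        gcongr
    _ = _ := by ring

/-- After the claimed number of steps, all but `√ε / 2` of the attention is on the feature of the
query, for every query at once and every balanced prompt. The constants `B` and `r₀` are those of
`abs_force_le` and `le_force_self_of_lt`. -/
theorem lead_of_gd {d K N : ℕ} {μ : Measure (Token d)} (hμ : IsTaskDist μ)
    {v : Fin K → Token d} (hv : Orthonormal ℝ v) {p : Fin K → ℝ} (hp1 : ∑ k, p k = 1)
    {c₁ C ρ B r₀ : ℝ} (hc₁ : 0 < c₁) (hp : ∀ k, c₁ / (K : ℝ) ≤ p k) (hρ1 : 1 ≤ ρ)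
    (hB : B = ρ * Real.exp 2 * (1 + 4 * ρ ^ 2 * Real.exp 3))
    (hr₀ : r₀ = 1 / (4096 * ρ ^ 4 * Real.exp 2))
    (hC : 4 / (c₁ * r₀) ≤ C) (hN : 0 < N) {a : ℕ}
    (hK4 : 4 ≤ K) (hKρ : 1024 * ρ ≤ K) (hKC : 6 * C ≤ K)
    (hKB : 8 * B * (2 * Real.log K + Real.log K ^ a) ≤ K)
    (hδ : unbalancedProb p N ρ ≤ Real.exp (-(10 * K)))
    {ε : ℝ} (hε : 0 < ε) (hε1 : ε < 1) (hεK : Real.log (1 / ε) ≤ Real.log (K : ℝ) ^ a)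
    {η : ℝ} (hη : 0 < η) {T : ℕ}
    (hT : T = ⌈C * ((K : ℝ) ^ 2 * Real.log (K : ℝ) / η +
      (K : ℝ) * Real.log ((K : ℝ) * ε ^ (-(1 / 2 : ℝ))) / (ε * η))⌉₊) :
    unbalancedProb p N ρ ≤ ε / 2 ∧ ∀ k, ∀ f : Fin N → Fin K, Balanced ρ f →
      1 - groupAttn (count f) (fun n => logit (gd μ v p N η T) (v n) (v k)) k ≤ √ε / 2 := by
  have hK : (4 : ℝ) ≤ K := by exact_mod_cast hK4
  have hK0 : (0 : ℝ) < K := by linarith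
  have hp0 : ∀ k, 0 < p k := fun k => (by positivity : 0 < c₁ / (K : ℝ)).trans_le (hp k)
  have hple : ∀ k, p k ≤ 1 := fun k =>
    hp1 ▸ Finset.single_le_sum (fun k _ => (hp0 k).le) (Finset.mem_univ k)
  have hr₀0 : 0 < r₀ := by rw [hr₀]; positivity
  have hC0 : 0 < C := lt_of_lt_of_le (by positivity) hC
  have hB1 : 1 ≤ B := by
    have : 1 ≤ Real.exp 2 := Real.one_le_exp (by norm_num)
    rw [hB]
    exact one_le_mul_of_one_le_of_one_le (one_le_mul_of_one_le_of_one_le hρ1 this)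
      (by have : 0 ≤ 4 * ρ ^ 2 * Real.exp 3 := by positivity
          linarith)
  set δ := unbalancedProb p N ρ
  set u := Real.log K with hu
  set w := -(1 / 2) * Real.log ε with hw
  have hu0 : 0 ≤ u := Real.log_nonneg (by linarith)
  have hlogε : Real.log (1 / ε) = 2 * w := by rw [one_div, Real.log_inv, hw]; ring
  have hw0 : 0 < w := by
    have := Real.log_neg hε hε1
    rw [hw]; linarith
  rw [hlogε] at hεK
  have hKB' : 16 * B * (u + w) ≤ K := by
    have := mul_le_mul_of_nonneg_left hεK (by linarith : 0 ≤ 8 * B)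
    linarith
  have huwK : 2 * (u + w) ≤ K := by
    have := mul_le_mul_of_nonneg_right hB1 (by linarith : 0 ≤ u + w)
    linarith
  have huK : u ≤ K := by linarith
  have huw : Real.log ((K : ℝ) * ε ^ (-(1 / 2 : ℝ))) = u + w := by
    rw [Real.log_mul hK0.ne' (by positivity), Real.log_rpow hε]
  -- `1 / ε` and polynomials in `K` are negligible against `exp (10 K)`
  have hεexp : Real.exp (-K) ≤ ε := by
    rw [← Real.le_log_iff_exp_le hε]
    linarith
  have hKexp : (K : ℝ) ≤ Real.exp K := by linarith [Real.add_one_le_exp (K : ℝ)]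
  have hδε : δ ≤ ε / 2 := by
    have h1 : Real.exp (-(10 * K)) = Real.exp (-K) * Real.exp (-(9 * K)) := by
      rw [← Real.exp_add]; congr 1; ring
    have h2 : Real.exp (-(9 * (K : ℝ))) ≤ 1 / 2 := by
      rw [Real.exp_neg, inv_le_comm₀ (Real.exp_pos _) (by norm_num)]
      linarith [Real.add_one_le_exp (9 * (K : ℝ))]
    calc δ ≤ _ := hδ
      _ ≤ ε * (1 / 2) := by
          rw [h1]
          exact mul_le_mul hεexp h2 (Real.exp_pos _).le hε.le
      _ = _ := by ring
  refine ⟨hδε, fun k f hf => ?_⟩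
  have hs := Real.sqrt_pos.2 hε
  have hlevel : 0 < 8 * ρ * K / √ε := by positivity
  set A := Real.log (8 * ρ * K / √ε) with hAdef
  have hA : Real.exp A = 8 * ρ * K / √ε := Real.exp_log hlevel
  have hAle : A ≤ 2 * (u + w) := by
    have h1 : A = Real.log (8 * ρ) + u + w := by
      rw [hAdef, Real.log_div (by positivity) hs.ne', Real.log_mul (by positivity) hK0.ne',
        Real.log_sqrt hε.le, hw]
      ring
    have h2 : Real.log (8 * ρ) ≤ u := Real.log_le_log (by positivity) (by linarith)
    linarith
  set H := C * ((K : ℝ) ^ 2 * u + K * (u + w) / ε) with hH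
  have hTH : T = ⌈H / η⌉₊ := by
    rw [hT, huw, hH]
    congr 1
    field_simp
  have hH0 : 0 ≤ H := by positivity
  have hT1 : H ≤ T * η := by
    rw [← div_le_iff₀ hη, hTH]
    exact Nat.le_ceil _
  have hT2 : ((T : ℝ) - 1) * η ≤ H := by
    rw [← le_div_iff₀ hη, hTH]
    linarith [Nat.ceil_lt_add_one (div_nonneg hH0 hη.le)]
  have hHδ : H * δ ≤ 1 / 2 := time_mul_le_half hK0 hC0 hKC hu0 huK (by linarith) huwK hεexp hδ
  set θ := ρ * Real.exp 2 / (K - 1) * (1 + 4 * ρ ^ 2 * Real.exp 3) with hθ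
  have hK1 : (0 : ℝ) < K - 1 := by linarith
  have hθB : θ = B / (K - 1) := by rw [hθ, hB]; ring
  set r := r₀ * min (1 / (K : ℝ)) ε with hr
  have hmin0 : 0 < min (1 / (K : ℝ)) ε := lt_min (by positivity) hε
  have hr0 : 0 < r := mul_pos hr₀0 hmin0
  have hθA : 2 * θ * A ≤ 1 / 2 := by
    rw [hθB, ← mul_div_assoc, div_mul_eq_mul_div, div_le_iff₀ hK1]
    have := mul_le_mul_of_nonneg_left hAle (by linarith : 0 ≤ 2 * B)
    linarith
  have hδr : δ ≤ θ * r := by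
    have h1 : Real.exp (-K) ≤ min (1 / (K : ℝ)) ε := by
      refine le_min ?_ hεexp
      rw [Real.exp_neg, one_div]
      gcongr
    have h2 : Real.exp (-K) ≤ θ := by
      rw [hθB, Real.exp_neg, ← one_div]
      exact div_le_div₀ (by linarith) hB1 hK1 (by linarith)
    have h3 : Real.exp (-(8 * K)) ≤ r₀ := by rw [hr₀]; exact exp_neg_le_rate hρ1 hKρ
    calc δ ≤ _ := hδ
      _ = Real.exp (-K) * (Real.exp (-(8 * K)) * Real.exp (-K)) := by
          rw [← Real.exp_add, ← Real.exp_add]; congr 1; ring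
      _ ≤ θ * r := by
          rw [hr]
          gcongr
  have hγ : 0 < η * p k := mul_pos hη (hp0 k)
  have hTA : A ≤ T * (η * p k * r) := by
    have h1 := add_le_time_mul_min hK0 hε hε1 hu hu0 hw
    have h2 : 4 ≤ C * (c₁ * r₀) := by rwa [div_le_iff₀ (by positivity)] at hC
    calc A ≤ 2 * (u + w) := hAle
      _ = 4 * ((u + w) / 2) := by ring
      _ ≤ C * (c₁ * r₀) *
          (((K : ℝ) ^ 2 * u + K * (u + w) / ε) * (min (1 / (K : ℝ)) ε / K)) :=
          mul_le_mul h2 h1 (by positivity) (by positivity)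
      _ = H * (c₁ / K * r) := by rw [hH, hr]; ring
      _ ≤ T * η * (p k * r) := by
          have := hp k
          gcongr
      _ = _ := by ring
  have hδ0 : 0 ≤ δ := unbalancedProb_nonneg (fun k => (hp0 k).le) ρ
  have hTδ : ((T : ℝ) - 1) * (η * p k * δ) ≤ 1 / 2 := by
    calc ((T : ℝ) - 1) * (η * p k * δ) = ((T : ℝ) - 1) * η * (p k * δ) := by ring
      _ ≤ H * (p k * δ) := mul_le_mul_of_nonneg_right hT2 (mul_nonneg (hp0 k).le hδ0)
      _ ≤ H * δ := by
          gcongr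
          exact mul_le_of_le_one_left hδ0 (hple k)
      _ ≤ _ := hHδ
  refine one_sub_groupAttn_le_sqrt hN hρ1 hε hA (fun n hn => ?_) hf
  refine lead_of_steps (b := fun t n => logit (gd μ v p N η t) (v n) (v k)) (by omega) hN
    (fun k => (hp0 k).le) hp1 hρ1 hε hε1 hγ hA hθ (by rw [hr, hr₀]) hθA (by linarith) hδr hTA hTδ
    (fun n => ?_) (fun t n => logit_gd_succ hμ hv (fun k => (hp0 k).le) hN η t n k) hn
  simp [gd, logit]

end ICL

end

theorem theorem1 (c₁ c₂ : ℝ) (hc₁ : 0 < c₁) (hc₂ : c₁ ≤ c₂) :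
    ∃ C c : ℝ, 0 < C ∧ 0 < c ∧ ∀ a : ℕ, ∃ K₀ : ℕ,
      ∀ K : ℕ, K₀ ≤ K →
      ∀ (d : ℕ) (v : Fin K → ICL.Token d), Orthonormal ℝ v →
      ∀ μ : MeasureTheory.Measure (ICL.Token d), ICL.IsTaskDist μ →
      ∀ p : Fin K → ℝ, ∑ k, p k = 1 → (∀ k, c₁ / (K : ℝ) ≤ p k ∧ p k ≤ c₂ / (K : ℝ)) →
      ∀ N : ℕ, K ^ 3 ≤ N →
        (Real.exp (-(C * ((N : ℝ) / (K : ℝ)))) ≤ ICL.optLoss μ v p N ∧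
          ICL.optLoss μ v p N ≤ Real.exp (-(c * ((N : ℝ) / (K : ℝ))))) ∧
        ∀ ε : ℝ, 0 < ε → ε < 1 → Real.log (1 / ε) ≤ Real.log (K : ℝ) ^ a →
        ∀ η : ℝ, 0 < η →
          ∃ T : ℕ,
            T ≤ ⌈C * ((K : ℝ) ^ 2 * Real.log (K : ℝ) / η +
                  (K : ℝ) * Real.log ((K : ℝ) * ε ^ (-(1 / 2 : ℝ))) / (ε * η))⌉₊ ∧
            ICL.loss μ v p N (ICL.gd μ v p N η T) - ICL.optLoss μ v p N ≤ ε ∧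
            ∀ k : Fin K,
              1 - Real.exp (-(c * ((N : ℝ) / (K : ℝ) ^ 2))) ≤
                (ICL.inputDist v p N).real
                  {X | (1 - ICL.featureAttn (ICL.gd μ v p N η T) v X (v k) k) ^ 2 ≤ C * ε} := by
  obtain ⟨ρ, hρ⟩ : ∃ ρ : ℝ, ρ = 4 * c₂ / c₁ := ⟨_, rfl⟩
  obtain ⟨B, hB⟩ : ∃ B : ℝ, B = ρ * Real.exp 2 * (1 + 4 * ρ ^ 2 * Real.exp 3) := ⟨_, rfl⟩
  obtain ⟨r₀, hr₀⟩ : ∃ r₀ : ℝ, r₀ = 1 / (4096 * ρ ^ 4 * Real.exp 2) := ⟨_, rfl⟩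
  obtain ⟨C, hC⟩ : ∃ C : ℝ, C = 4 / (c₁ * r₀) + 2 * c₂ + 1 := ⟨_, rfl⟩
  have hc₂0 : 0 < c₂ := hc₁.trans_le hc₂
  have hρ1 : 1 ≤ ρ := by
    rw [hρ, one_le_div hc₁]
    linarith
  have hr₀0 : 0 < r₀ := by rw [hr₀]; positivity
  have hCr : 0 < 4 / (c₁ * r₀) := by positivity
  refine ⟨C, c₁ / 20, by linarith, by positivity, fun a => ?_⟩
  obtain ⟨K₀, hK₀⟩ := ICL.exists_nat_threshold
    (4 + 2 * c₂ + 1024 * ρ + 6 * C + 200 / c₁) (8 * B) a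
  refine ⟨K₀, fun K hK d v hv μ hμ p hp1 hp N hN => ?_⟩
  obtain ⟨hKM, hKB⟩ := hK₀ K hK
  have h200 : 0 < 200 / c₁ := by positivity
  have hK4 : (4 : ℝ) ≤ K := by linarith
  have hK0 : (0 : ℝ) < K := by linarith
  have hK4' : 4 ≤ K := by exact_mod_cast hK4
  have hKc : 10 ≤ c₁ / 20 * K := by
    have : 200 / c₁ ≤ K := by linarith
    rw [div_le_iff₀ hc₁] at this
    linarith
  have hN0 : 0 < N := lt_of_lt_of_le (pow_pos (by omega) 3) hN
  have hp0 : ∀ k, 0 ≤ p k := fun k => (by positivity : 0 ≤ c₁ / (K : ℝ)).trans (hp k).1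
  -- `x` is the order of the expected number of occurrences of a feature in a prompt
  obtain ⟨x, hx⟩ : ∃ x : ℝ, x = N / K := ⟨_, rfl⟩
  have hxK : (K : ℝ) ^ 2 ≤ x := by
    rw [hx, le_div_iff₀ hK0, ← pow_succ]
    exact_mod_cast hN
  have hcx : 10 * K ≤ c₁ / 20 * x := by
    calc 10 * (K : ℝ) ≤ c₁ / 20 * K * K := by gcongr
      _ = c₁ / 20 * K ^ 2 := by ring
      _ ≤ _ := by gcongr
  have hδ : ICL.unbalancedProb p N ρ ≤ Real.exp (-(c₁ / 20 * x)) := by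
    have h1 := ICL.sum_drawProb_not_balanced hc₁ (by omega) hN0 hp hp1
    rw [← hρ, ← hx] at h1
    refine h1.trans ?_
    rw [show c₁ / 10 * x = 2 * (c₁ / 20) * x by ring]
    exact ICL.mul_exp_neg_mul_sq_le (by positivity) hK4 (by linarith) hxK
  refine ⟨⟨?_, ?_⟩, ?_⟩
  · have hq : c₂ / (K : ℝ) ≤ 1 / 2 := by
      rw [div_le_iff₀ hK0]
      linarith
    refine le_trans ?_ (ICL.exp_le_optLoss hμ hv hp0 hp1 (fun k => (hp k).2) hq)
    have e1 : 2 * (c₂ / K) * N = 2 * c₂ * x := by rw [hx]; ring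
    have h2 : Real.exp (-x) ≤ 1 / 2 := by
      rw [Real.exp_neg, inv_le_comm₀ (Real.exp_pos _) (by norm_num)]
      nlinarith [Real.add_one_le_exp x]
    rw [e1, ← hx]
    calc Real.exp (-(C * x)) ≤ Real.exp (-x + -(2 * c₂ * x)) := by
          apply Real.exp_le_exp.2
          have : 0 < x := by nlinarith
          nlinarith
      _ ≤ _ := by
          rw [Real.exp_add]
          gcongr
  · have hq : c₁ / (K : ℝ) ≤ 1 := by
      rw [div_le_iff₀ hK0]
      linarith
    refine (ICL.optLoss_le_exp hμ hv hp1 hN0 (by positivity) (fun k => (hp k).1) hq).trans ?_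
    have e1 : c₁ / K * N = c₁ * x := by rw [hx]; ring
    have h2 : 2 ≤ Real.exp (19 / 20 * (c₁ * x)) := by
      linarith [Real.add_one_le_exp (19 / 20 * (c₁ * x))]
    rw [e1, ← hx]
    calc 2 * Real.exp (-(c₁ * x)) ≤ Real.exp (19 / 20 * (c₁ * x)) * Real.exp (-(c₁ * x)) := by
          gcongr
      _ = _ := by rw [← Real.exp_add]; congr 1; ring
  · intro ε hε hε1 hεK η hη
    obtain ⟨T, hT⟩ : ∃ T : ℕ, T = ⌈C * ((K : ℝ) ^ 2 * Real.log (K : ℝ) / η +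
        (K : ℝ) * Real.log ((K : ℝ) * ε ^ (-(1 / 2 : ℝ))) / (ε * η))⌉₊ := ⟨_, rfl⟩
    refine ⟨T, hT.le, ?_⟩
    obtain ⟨hδε, hlead⟩ := ICL.lead_of_gd hμ hv hp1 hc₁ (fun k => (hp k).1) hρ1 hB hr₀
      (by linarith : 4 / (c₁ * r₀) ≤ C) hN0 hK4' (by linarith) (by linarith) hKB
      (hδ.trans (Real.exp_le_exp.2 (by linarith))) hε hε1 hεK hη hT
    have hsq : (√ε / 2) ^ 2 = ε / 4 := by
      rw [div_pow, Real.sq_sqrt hε.le]; norm_num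
    refine ⟨?_, fun k => ?_⟩
    · have h1 := ICL.loss_le_of_balanced hμ hv hp0 hp1 hN0 hlead
      have h2 : 0 ≤ ICL.optLoss μ v p N := Real.iInf_nonneg fun Q => ICL.loss_nonneg μ v p N Q
      linarith
    · refine le_trans ?_ (ICL.le_inputDist_real hv hp0 hp1 (ρ := ρ) fun f hf => ?_)
      · have h1 : Real.exp (-(c₁ / 20 * x)) ≤ Real.exp (-(c₁ / 20 * ((N : ℝ) / (K : ℝ) ^ 2))) := by
          apply Real.exp_le_exp.2
          have : (N : ℝ) / (K : ℝ) ^ 2 ≤ x := by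
            rw [hx]
            gcongr
            nlinarith
          have := mul_le_mul_of_nonneg_left this (by positivity : 0 ≤ c₁ / 20)
          linarith
        linarith
      · have h1 := fun b => ICL.prob_le_one (ICL.groupAttn_count_nonneg f b)
          (ICL.sum_groupAttn_count hN0 f b) k
        refine (pow_le_pow_left₀ (sub_nonneg.2 (h1 _)) (hlead k f hf) 2).trans ?_
        rw [hsq]
        nlinarith
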